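/- Let $(\Omega,\mathcal F,P)$ be a probability space that is nonatomic, i.e. it supports a random variable with a continuous distribution, and write $L^\infty(P)=L^\infty(\Omega,\mathcal F,P)$. A map $\rho:L^\infty(P)\to\mathbb R$ is a *monetary risk measure* if $X\le Y$ $P$-a.s. implies $\rho(X)\ge\rho(Y)$, and $\rho(X+m)=\rho(X)-m$ for all $m\in\mathbb R$. It is *SSD-consistent* if moreover $\rho(X)\le\rho(Y)$ whenever $E_P[f(X)]\ge E_P[f(Y)]$ for all increasing (i.e. non-decreasing) concave $f:\mathbb R\to\mathbb R$. Random variables $X,Y\in L^\infty(P)$ are *comonotonic* if there is $\Omega_0\in\mathcal F$ with $P(\Omega_0)=1$ and $(X(\omega)-X(\omega'))(Y(\omega)-Y(\omega'))\ge0$ for all $\omega,\omega'\in\Omega_0$. A monetary risk measure $\rho$ is *CoM-convex* if $\rho(aX+(1-a)Y)\le a\rho(X)+(1-a)\rho(Y)$ for all comonotonic $X,Y\in L^\infty(P)$ and $a\in[0,1]$; it is *CoM-coherent* if in addition $\rho(aX)=a\rho(X)$ for all $X\in L^\infty(P)$ and $a\ge0$. For $X\in L^\infty(P)$ with distribution function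 $F_X$ put $q_X(t)=\inf\{x\in\mathbb R: F_X(x)>t\}$ for $t\in[0,1)$, $q_X(1)=\lim_{t\uparrow1}q_X(t)$, and $\mathrm{VaR}_t(X)=-q_X(t)$ for $t\in[0,1]$. Let $\mathcal W$ be the set of all increasing right-continuous functions $w:[0,1]\to[0,1]$ with $w(1)=1$, identified with the probability distributions on $[0,1]$ (so that $\{0\}$ has mass $w(0)$), with the weak topology induced by the continuous functions on $[0,1]$. Let $\Psi=\{\psi\in\mathcal W:\psi\text{ is concave on }[0,1]\}$, with the topology transported from $\mathcal W$ by the bijection $J:\mathcal W\to\Psi$, $w\mapsto\psi$, where $\psi(0)=w(0)$ and the right derivative of $\psi$ is $\psi'(t)=\int_{(t,1]}s^{-1}\,dw(s)$ for $t\in[0,1)$. (a) If $\rho:L^\infty(P)\to\mathbb R$ is an SSD-consistent CoM-convex risk measure, then there exists a lower semicontinuous convex functional $\alpha:\Psi\to(-\infty,\infty]$ such that $$\rho(X)=\max_{\psi\in\Psi}\left(\int_{[0,1]}\mathrm{VaR}_t(X)\,\psi(dt)-\alpha(\psi)\right)\quad\text{for all }X\in L^\infty(P),$$ the maximum being attained.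 (b) If $\rho$ is SSD-consistent and CoM-coherent, then there exists a nonempty, compact and convex subset $\Psi_1\subseteq\Psi$ such that $$\rho(X)=\max_{\psi\in\Psi_1}\int_{[0,1]}\mathrm{VaR}_t(X)\,\psi(dt)\quad\text{for all }X\in L^\infty(P),$$ the maximum being attained. -/

import Mathlib

open MeasureTheory Set Filter Topology
open scoped ENNReal

/-! ### Risk measures on `L^∞(P)` -/

/-- The probability space is nonatomic: it supports a random variable with a continuous
distribution. -/
def IsNonatomicSpace {Ω : Type*} [MeasurableSpace Ω] (P : Measure Ω) : Prop :=
  ∃ U : Ω → ℝ, Measurable U ∧ Continuous (fun x : ℝ => P.real {ω | U ω ≤ x})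

/-- Monetary risk measures on `L^∞(P)`: decreasing and cash-additive functionals. -/
structure IsMonetaryRiskMeasure {Ω : Type*} [MeasurableSpace Ω] {P : Measure Ω}
    [IsFiniteMeasure P] (ρ : Lp ℝ ∞ P → ℝ) : Prop where
  monotonicity : ∀ X Y : Lp ℝ ∞ P, X ≤ᵐ[P] Y → ρ Y ≤ ρ X
  translation : ∀ (X : Lp ℝ ∞ P) (m : ℝ), ρ (X + Lp.const ∞ P m) = ρ X - m

/-- Second-order stochastic dominance `X ⪰₂ Y`. -/
def SSDominates {Ω : Type*} [MeasurableSpace Ω] {P : Measure Ω} (X Y : Lp ℝ ∞ P) : Prop :=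
  ∀ f : ℝ → ℝ, Monotone f → ConcaveOn ℝ univ f → ∫ ω, f (Y ω) ∂P ≤ ∫ ω, f (X ω) ∂P

/-- `ρ` is an SSD-consistent (monetary) risk measure. -/
structure IsSSDConsistent {Ω : Type*} [MeasurableSpace Ω] {P : Measure Ω}
    [IsFiniteMeasure P] (ρ : Lp ℝ ∞ P → ℝ) : Prop extends IsMonetaryRiskMeasure ρ where
  ssd : ∀ X Y : Lp ℝ ∞ P, SSDominates X Y → ρ X ≤ ρ Y

/-- Two random variables are comonotonic. -/
def Comonotonic {Ω : Type*} [MeasurableSpace Ω] {P : Measure Ω} (X Y : Lp ℝ ∞ P) : Prop :=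
  ∃ Ω₀ : Set Ω, MeasurableSet Ω₀ ∧ P Ω₀ = 1 ∧
    ∀ ω ∈ Ω₀, ∀ ω' ∈ Ω₀, 0 ≤ (X ω - X ω') * (Y ω - Y ω')

/-- `ρ` is a comonotonic convex (monetary) risk measure. -/
structure IsCoMConvex {Ω : Type*} [MeasurableSpace Ω] {P : Measure Ω}
    [IsFiniteMeasure P] (ρ : Lp ℝ ∞ P → ℝ) : Prop extends IsMonetaryRiskMeasure ρ where
  convexity : ∀ X Y : Lp ℝ ∞ P, Comonotonic X Y → ∀ a : ℝ, 0 ≤ a → a ≤ 1 →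
    ρ (a • X + (1 - a) • Y) ≤ a * ρ X + (1 - a) * ρ Y

/-- `ρ` is a comonotonic coherent (monetary) risk measure: comonotonic convex and positively
homogeneous. -/
structure IsCoMCoherent {Ω : Type*} [MeasurableSpace Ω] {P : Measure Ω}
    [IsFiniteMeasure P] (ρ : Lp ℝ ∞ P → ℝ) : Prop extends IsCoMConvex ρ where
  homogeneity : ∀ (X : Lp ℝ ∞ P) (a : ℝ), 0 ≤ a → ρ (a • X) = a * ρ X

/-! ### Quantiles and value at risk -/

/-- The upper quantile `inf {x | F_X(x) > t}`, for `t ∈ [0,1)`. -/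
noncomputable def upperQuantile {Ω : Type*} [MeasurableSpace Ω] {P : Measure Ω}
    (X : Lp ℝ ∞ P) (t : ℝ) : ℝ :=
  sInf {x : ℝ | t < P.real {ω | X ω ≤ x}}

/-- The quantile function `q_X` on `[0,1]`, with `q_X(1) = lim_{t ↑ 1} q_X(t)`. -/
noncomputable def quantile {Ω : Type*} [MeasurableSpace Ω] {P : Measure Ω}
    (X : Lp ℝ ∞ P) (t : ℝ) : ℝ :=
  if t < 1 then upperQuantile X t else limUnder (𝓝[<] (1 : ℝ)) (upperQuantile X)

/-- Value at risk at level `t ∈ [0,1]`. -/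
noncomputable def VaR {Ω : Type*} [MeasurableSpace Ω] {P : Measure Ω}
    (t : ℝ) (X : Lp ℝ ∞ P) : ℝ :=
  -quantile X t

/-! ### Distribution functions on `[0,1]` -/

/-- The set `𝒲` of probability distribution functions on `[0,1]`: increasing right-continuous
functions `w` on `[0,1]` with `0 ≤ w 0` and `w 1 = 1`. As usual, `w` is extended to the real line
by `0` on the left of `[0,1]` and by `1` on the right. -/
structure UnitDF extends StieltjesFunction ℝ where
  eq_zero' : ∀ t < 0, toFun t = 0
  eq_one' : ∀ t, 1 ≤ t → toFun t = 1

namespace UnitDF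

/-- The probability measure with distribution function `w`. -/
noncomputable def measure (w : UnitDF) : Measure ℝ :=
  w.toStieltjesFunction.measure

/-- The weak topology on `𝒲`: the coarsest one making `w ↦ ∫_{[0,1]} f dw` continuous for each
continuous function `f` on `[0,1]`. -/
noncomputable instance : TopologicalSpace UnitDF :=
  ⨅ (f : ℝ → ℝ) (_ : ContinuousOn f (Icc 0 1)),
    TopologicalSpace.induced (fun w : UnitDF => ∫ t in Icc 0 1, f t ∂w.measure) inferInstance

end UnitDF

/-- The set `Ψ` of all `ψ ∈ 𝒲` that are concave on `[0,1]`. -/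
structure ConcaveDF extends UnitDF where
  concave' : ConcaveOn ℝ (Icc 0 1) toFun

namespace ConcaveDF

/-- The probability measure with distribution function `ψ`. -/
noncomputable def measure (ψ : ConcaveDF) : Measure ℝ :=
  ψ.toUnitDF.measure

/-- The mixture `a φ + (1 - a) ψ` in `Ψ`, for `0 ≤ a ≤ 1`. -/
def mix (a : ℝ) (h₀ : 0 ≤ a) (h₁ : a ≤ 1) (φ ψ : ConcaveDF) : ConcaveDF where
  toFun t := a * φ.toFun t + (1 - a) * ψ.toFun t
  mono' := (φ.mono'.const_mul h₀).add (ψ.mono'.const_mul (sub_nonneg.2 h₁))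
  right_continuous' x := (continuousWithinAt_const.mul (φ.right_continuous' x)).add
    (continuousWithinAt_const.mul (ψ.right_continuous' x))
  eq_zero' t ht := by rw [φ.eq_zero' t ht, ψ.eq_zero' t ht]; ring
  eq_one' t ht := by rw [φ.eq_one' t ht, ψ.eq_one' t ht]; ring
  concave' := (φ.concave'.smul h₀).add (ψ.concave'.smul (sub_nonneg.2 h₁))

/-- Convexity of a functional `α : Ψ → (-∞,∞]`. -/
def ConvexFunctional (α : ConcaveDF → EReal) : Prop :=
  ∀ (φ ψ : ConcaveDF) (a : ℝ) (h₀ : 0 ≤ a) (h₁ : a ≤ 1),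
    α (mix a h₀ h₁ φ ψ) ≤ (a : EReal) * α φ + ((1 - a : ℝ) : EReal) * α ψ

/-- Convexity of a subset of `Ψ`. -/
def ConvexSubset (S : Set ConcaveDF) : Prop :=
  ∀ φ ∈ S, ∀ ψ ∈ S, ∀ (a : ℝ) (h₀ : 0 ≤ a) (h₁ : a ≤ 1), mix a h₀ h₁ φ ψ ∈ S

end ConcaveDF

/-! ### The bijection `J : 𝒲 → Ψ` and the topology of `Ψ` -/

namespace UnitDF

theorem nonneg (w : UnitDF) (t : ℝ) : 0 ≤ w.toFun t := by
  rcases lt_or_ge t 0 with h | h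
  · exact (w.eq_zero' t h).ge
  · have h1 := w.mono' (show min t (-1) ≤ t from min_le_left _ _)
    have h2 := w.eq_zero' (min t (-1)) (lt_of_le_of_lt (min_le_right _ _) (by norm_num))
    linarith

theorem isProbabilityMeasure (w : UnitDF) : IsProbabilityMeasure w.measure := by
  refine StieltjesFunction.isProbabilityMeasure (f := w.toStieltjesFunction) ?_ ?_
  · refine tendsto_const_nhds.congr' ?_
    filter_upwards [eventually_lt_atBot (0 : ℝ)] with t ht
    exact (w.eq_zero' t ht).symm
  · refine tendsto_const_nhds.congr' ?_
    filter_upwards [eventually_ge_atTop (1 : ℝ)] with t ht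
    exact (w.eq_one' t ht).symm

theorem measureReal_Ioc (w : UnitDF) : w.measure.real (Ioc 0 1) = 1 - w.toFun 0 := by
  have h : w.measure (Ioc 0 1) = ENNReal.ofReal (w.toFun 1 - w.toFun 0) :=
    StieltjesFunction.measure_Ioc w.toStieltjesFunction 0 1
  have h0 : w.toFun 0 ≤ w.toFun 1 := w.mono' zero_le_one
  rw [Measure.real, h, ENNReal.toReal_ofReal (by linarith), w.eq_one' 1 le_rfl]

/-- The density `ψ'(t) = ∫_{(t,1]} s⁻¹ dw(s)`. -/
noncomputable def density (w : UnitDF) (t : ℝ) : ℝ :=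
  ∫ s in Ioc t 1, s⁻¹ ∂w.measure

/-- `ψ(t)` for `t ∈ [0,1]`, where `ψ(0) = w(0)` and `ψ' = density w`. -/
noncomputable def concaveFun (w : UnitDF) (t : ℝ) : ℝ :=
  w.toFun 0 + ∫ u in (0 : ℝ)..t, w.density u

theorem concaveFun_eq (w : UnitDF) {t : ℝ} (h0 : 0 ≤ t) (h1 : t ≤ 1) :
    w.concaveFun t = w.toFun 0 + ∫ s in Ioc (0 : ℝ) 1, min t s / s ∂w.measure := by
  have := w.isProbabilityMeasure
  have key : ∀ s ∈ Ioc (0 : ℝ) 1,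
      ∫ u in Ioc 0 t, (Iio s).indicator (fun _ => s⁻¹) u = min t s / s := by
    intro s hs
    rw [setIntegral_indicator measurableSet_Iio, setIntegral_const]
    have : volume.real (Ioc 0 t ∩ Iio s) = min t s := by
      rcases le_or_gt s t with h | h
      · have : Ioc 0 t ∩ Iio s = Ioo 0 s := by
          ext x; simp only [mem_inter_iff, mem_Ioc, mem_Iio, mem_Ioo]
          constructor
          · rintro ⟨⟨a, b⟩, c⟩; exact ⟨a, c⟩
          · rintro ⟨a, b⟩; exact ⟨⟨a, by linarith⟩, b⟩
        rw [this, min_eq_right h]; simp [Measure.real, hs.1.le]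
      · have : Ioc 0 t ∩ Iio s = Ioc 0 t := by
          apply inter_eq_left.2; intro x hx; exact lt_of_le_of_lt hx.2 h
        rw [this, min_eq_left h.le]; simp [Measure.real, h0]
    rw [this, smul_eq_mul, div_eq_mul_inv]
  unfold concaveFun
  congr 1
  rw [intervalIntegral.integral_of_le h0]
  have e1 : ∫ u in Ioc 0 t, w.density u =
      ∫ u in Ioc 0 t, ∫ s in Ioc (0 : ℝ) 1, (Iio s).indicator (fun _ => s⁻¹) u ∂w.measure := by
    refine setIntegral_congr_fun measurableSet_Ioc fun u hu => ?_
    have : (fun s : ℝ => (Iio s).indicator (fun _ => s⁻¹) u) =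
        (Ioi u).indicator (fun s => s⁻¹) := by
      ext s; simp [indicator]
    simp only [density, this]
    rw [setIntegral_indicator measurableSet_Ioi]
    congr 2
    ext x; simp only [mem_inter_iff, mem_Ioc, mem_Ioi]
    constructor
    · rintro ⟨a, b⟩; exact ⟨⟨hu.1.trans a, b⟩, a⟩
    · rintro ⟨⟨a, b⟩, c⟩; exact ⟨c, b⟩
  have hmeas : Measurable (fun p : ℝ × ℝ => (Iio p.2).indicator (fun _ => p.2⁻¹) p.1) := by
    have : (fun p : ℝ × ℝ => (Iio p.2).indicator (fun _ => p.2⁻¹) p.1) =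
        {p : ℝ × ℝ | p.1 < p.2}.indicator (fun p => p.2⁻¹) := by
      ext p; simp [indicator]
    rw [this]
    exact measurable_snd.inv.indicator (measurableSet_lt measurable_fst measurable_snd)
  rw [e1, integral_integral_swap]
  · exact setIntegral_congr_fun measurableSet_Ioc key
  · refine (integrable_prod_iff' hmeas.aestronglyMeasurable).2 ⟨?_, ?_⟩
    · refine Eventually.of_forall fun s => ?_
      exact (integrable_const s⁻¹).indicator measurableSet_Iio
    · refine Integrable.of_bound (C := 1) ?_ ?_
      · exact (hmeas.norm.stronglyMeasurable.integral_prod_left').aestronglyMeasurable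
      · filter_upwards [ae_restrict_mem measurableSet_Ioc] with s hs
        have : ∀ u, ‖(Iio s).indicator (fun _ => s⁻¹) u‖ = (Iio s).indicator (fun _ => s⁻¹) u := by
          intro u
          exact Real.norm_of_nonneg (indicator_nonneg (fun _ _ => (inv_pos.2 hs.1).le) u)
        simp only [this, key s hs]
        rw [Real.norm_of_nonneg (div_nonneg (le_min h0 hs.1.le) hs.1.le)]
        exact (div_le_one hs.1).2 (min_le_right _ _)

theorem integrable_kernel (w : UnitDF) {t : ℝ} (h0 : 0 ≤ t) :
    Integrable (fun s : ℝ => min t s / s) (w.measure.restrict (Ioc 0 1)) := by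
  have := w.isProbabilityMeasure
  refine Integrable.of_bound (C := 1) ?_ ?_
  · exact ((measurable_const.min measurable_id).div measurable_id).aestronglyMeasurable
  · filter_upwards [ae_restrict_mem measurableSet_Ioc] with s hs
    rw [Real.norm_of_nonneg (div_nonneg (le_min h0 hs.1.le) hs.1.le)]
    exact (div_le_one hs.1).2 (min_le_right _ _)

theorem concaveFun_zero (w : UnitDF) : w.concaveFun 0 = w.toFun 0 := by
  simp [concaveFun]

theorem concaveFun_one (w : UnitDF) : w.concaveFun 1 = 1 := by
  have := w.isProbabilityMeasure
  rw [w.concaveFun_eq zero_le_one le_rfl]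
  have : ∫ s in Ioc (0 : ℝ) 1, min 1 s / s ∂w.measure = ∫ s in Ioc (0 : ℝ) 1, 1 ∂w.measure := by
    refine setIntegral_congr_fun measurableSet_Ioc fun s hs => ?_
    simp only [min_eq_right hs.2, div_self hs.1.ne']
  rw [this]
  simp only [integral_const, measureReal_restrict_apply_univ, smul_eq_mul, mul_one,
    w.measureReal_Ioc]
  ring

theorem concaveFun_monotoneOn (w : UnitDF) : MonotoneOn w.concaveFun (Icc 0 1) := by
  intro s hs t ht hst
  rw [w.concaveFun_eq hs.1 hs.2, w.concaveFun_eq ht.1 ht.2]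
  gcongr 1
  refine setIntegral_mono_on (w.integrable_kernel hs.1) (w.integrable_kernel ht.1)
    measurableSet_Ioc fun x hx => ?_
  exact div_le_div_of_nonneg_right (min_le_min_right _ hst) hx.1.le

theorem concaveFun_concaveOn (w : UnitDF) : ConcaveOn ℝ (Icc 0 1) w.concaveFun := by
  refine ⟨convex_Icc 0 1, fun s hs t ht a b ha hb hab => ?_⟩
  have hm : a • s + b • t ∈ Icc (0 : ℝ) 1 := convex_Icc (0 : ℝ) 1 hs ht ha hb hab
  rw [w.concaveFun_eq hs.1 hs.2, w.concaveFun_eq ht.1 ht.2, w.concaveFun_eq hm.1 hm.2]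
  have hi : ∫ x in Ioc (0 : ℝ) 1, (a * (min s x / x) + b * (min t x / x)) ∂w.measure ≤
      ∫ x in Ioc (0 : ℝ) 1, min (a • s + b • t) x / x ∂w.measure := by
    refine setIntegral_mono_on (((w.integrable_kernel hs.1).const_mul a).add
      ((w.integrable_kernel ht.1).const_mul b)) (w.integrable_kernel hm.1)
      measurableSet_Ioc fun x hx => ?_
    rw [← mul_div_assoc, ← mul_div_assoc, ← add_div]
    refine div_le_div_of_nonneg_right (le_min ?_ ?_) hx.1.le
    · simp only [smul_eq_mul]
      exact add_le_add (mul_le_mul_of_nonneg_left (min_le_left _ _) ha)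
        (mul_le_mul_of_nonneg_left (min_le_left _ _) hb)
    · calc a * min s x + b * min t x ≤ a * x + b * x :=
            add_le_add (mul_le_mul_of_nonneg_left (min_le_right _ _) ha)
              (mul_le_mul_of_nonneg_left (min_le_right _ _) hb)
        _ = x := by rw [← add_mul, hab, one_mul]
  rw [integral_add ((w.integrable_kernel hs.1).const_mul a)
    ((w.integrable_kernel ht.1).const_mul b), integral_const_mul, integral_const_mul] at hi
  have hw : a * w.toFun 0 + b * w.toFun 0 = w.toFun 0 := by rw [← add_mul, hab, one_mul]
  simp only [smul_eq_mul] at hi ⊢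
  linarith

theorem concaveFun_continuousOn (w : UnitDF) : ContinuousOn w.concaveFun (Icc 0 1) := by
  have := w.isProbabilityMeasure
  have h : ContinuousOn (fun t => w.toFun 0 + ∫ s in Ioc (0 : ℝ) 1, min t s / s ∂w.measure)
      (Icc 0 1) := by
    refine continuousOn_const.add ?_
    refine continuousOn_of_dominated (bound := fun _ => 1) (fun t ht => ?_) (fun t ht => ?_)
      (integrable_const _) ?_
    · exact (w.integrable_kernel ht.1).aestronglyMeasurable
    · filter_upwards [ae_restrict_mem measurableSet_Ioc] with s hs
      rw [Real.norm_of_nonneg (div_nonneg (le_min ht.1 hs.1.le) hs.1.le)]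
      exact (div_le_one hs.1).2 (min_le_right _ _)
    · refine Eventually.of_forall fun s => ?_
      exact ((continuous_id.min continuous_const).div_const s).continuousOn
  exact h.congr fun t ht => w.concaveFun_eq ht.1 ht.2

/-- The map `J : 𝒲 → Ψ`, `w ↦ ψ` with `ψ(0) = w(0)` and `ψ'(t) = ∫_{(t,1]} s⁻¹ dw(s)`. -/
noncomputable def J (w : UnitDF) : ConcaveDF where
  toFun t := if t < 0 then 0 else w.concaveFun (min t 1)
  mono' s t hst := by
    have h0 : 0 ≤ w.concaveFun 0 := w.concaveFun_zero.symm ▸ w.nonneg 0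
    dsimp only
    split_ifs with h1 h2 h2
    · exact le_rfl
    · exact h0.trans (w.concaveFun_monotoneOn (by simp)
        ⟨le_min (not_lt.1 h2) zero_le_one, min_le_right _ _⟩
        (le_min (not_lt.1 h2) zero_le_one))
    · exact absurd (lt_of_le_of_lt hst h2) h1
    · exact w.concaveFun_monotoneOn ⟨le_min (not_lt.1 h1) zero_le_one, min_le_right _ _⟩
        ⟨le_min (not_lt.1 h2) zero_le_one, min_le_right _ _⟩ (min_le_min_right _ hst)
  right_continuous' x := by
    rcases lt_or_ge x 0 with h | h
    · refine ContinuousAt.continuousWithinAt ?_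
      refine (continuousAt_const (y := (0 : ℝ))).congr ?_
      filter_upwards [Iio_mem_nhds h] with t ht
      exact (if_pos ht).symm
    · have hc : ContinuousWithinAt (fun t => w.concaveFun (min t 1)) (Ici x) x := by
        refine (w.concaveFun_continuousOn.comp (s := Ici 0)
          (continuous_id.min continuous_const).continuousOn ?_ x h).mono (Ici_subset_Ici.2 h)
        intro t ht
        exact ⟨le_min ht zero_le_one, min_le_right _ _⟩
      refine hc.congr (fun t ht => if_neg (not_lt.2 (h.trans ht))) (if_neg (not_lt.2 h))
  eq_zero' t ht := if_pos ht
  eq_one' t ht := by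
    rw [if_neg (by linarith), min_eq_right ht, w.concaveFun_one]
  concave' := w.concaveFun_concaveOn.congr fun t ht => by
    rw [if_neg (not_lt.2 ht.1), min_eq_left ht.2]

end UnitDF

/-- The topology on `Ψ` transported from the weak topology of `𝒲` by the bijection `J`. -/
noncomputable instance : TopologicalSpace ConcaveDF :=
  TopologicalSpace.coinduced UnitDF.J inferInstance

/-! Everything is read off the curve `avgVaR X`, s ↦ -(1/s)∫_0^s q_X(u) du, which extends
continuously to s = 0 because q_X is right-continuous there.

If the curve of X lies below that of Y, then X dominates Y in second order
(`ssDominates_of_avgVaR_le`). Hence an SSD-consistent ρ is an increasing function of the curve, and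
adding cash m to X lowers the curve by m. On a nonatomic space X and Y have comonotonic copies
q_X(V), q_Y(V) with V uniform. Quantiles of comonotonic mixtures are mixtures of quantiles, so the
curves form a convex subset of C[0,1] on which CoM-convexity makes ρ convex
(`IsCoMConvex.exists_avgVaR_eq`).

Convex duality on C[0,1] now applies. The directional derivative of ρ at a curve, relaxed to
arbitrary directions by monotonicity, is finite and sublinear. Hahn–Banach gives a linear functional
below it, which is positive and normalized, and the Riesz theorem represents it by some w in 𝒲
(`IsCoMConvex.exists_unitDF`). Fubini turns ∫ avgVaR dw into ∫ VaR d(J w) (`setIntegral_VaR_J`), so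
w becomes an element of Ψ.

For (a), the penalty is the supremum over X of ∫ VaR(X) dψ - ρ(X), a supremum of continuous affine
functionals of ψ; the supporting functional at X attains the maximum. For (b), homogeneity places
the supporting functionals in the set of w dominated by ρ, which is closed in the compact space 𝒲,
and its image under J is Ψ₁. Surjectivity of J is not needed. -/

section Quantiles

/-! ### Upper quantile functions and comonotonic copies -/

variable {Ω : Type*} [MeasurableSpace Ω] {P : Measure Ω}

theorem Lp.measurable_coe (X : Lp ℝ ∞ P) : Measurable (X : Ω → ℝ) :=
  (Lp.stronglyMeasurable X).measurable

theorem Lp.ae_abs_le_norm (X : Lp ℝ ∞ P) : ∀ᵐ ω ∂P, |X ω| ≤ ‖X‖ := by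
  have hfin := (Lp.memLp X).eLpNorm_lt_top
  rw [eLpNorm_exponent_top] at hfin
  filter_upwards [ae_le_eLpNormEssSup (f := (X : Ω → ℝ)) (μ := P)] with ω hω
  rw [Lp.norm_def, eLpNorm_exponent_top, ← Real.norm_eq_abs, ← toReal_enorm]
  exact ENNReal.toReal_mono hfin.ne hω

theorem neg_norm_le_of_measureReal_pos (X : Lp ℝ ∞ P) {t x : ℝ} (ht : 0 ≤ t)
    (h : t < P.real {ω | X ω ≤ x}) : -‖X‖ ≤ x := by
  by_contra! hx
  have h0 : P {ω | X ω ≤ x} = 0 := by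
    rw [measure_eq_zero_iff_ae_notMem]
    filter_upwards [Lp.ae_abs_le_norm X] with ω hω hω'
    linarith [neg_le_of_abs_le hω, show X ω ≤ x from hω']
  rw [Measure.real, h0] at h
  simp at h
  linarith

theorem upperQuantile_le (X : Lp ℝ ∞ P) {t x : ℝ} (ht : 0 ≤ t)
    (h : t < P.real {ω | X ω ≤ x}) : upperQuantile X t ≤ x :=
  csInf_le ⟨-‖X‖, fun _ hy => neg_norm_le_of_measureReal_pos X ht hy⟩ h

/-- The upper quantile function, extended to a bounded monotone function on the line. -/
noncomputable def quantileExt (X : Lp ℝ ∞ P) (t : ℝ) : ℝ :=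
  if t < 1 then upperQuantile X (max t 0) else ‖X‖

theorem quantileExt_of_mem (X : Lp ℝ ∞ P) {t : ℝ} (ht : t ∈ Ico (0 : ℝ) 1) :
    quantileExt X t = upperQuantile X t := by
  rw [quantileExt, if_pos ht.2, max_eq_left ht.1]

/-- A monotone function that is right-continuous on `[0,1)` and transports Lebesgue measure to the
law of `X` is the upper quantile function of `X`. -/
theorem quantileExt_eq_of_map_eq (X : Lp ℝ ∞ P) {φ : ℝ → ℝ} (hφ : Monotone φ)
    (hc : ∀ t ∈ Ico (0 : ℝ) 1, ContinuousWithinAt φ (Ici t) t)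
    (hX : P.map X = (volume.restrict (Ico (0 : ℝ) 1)).map φ) {t : ℝ} (ht : t ∈ Ico (0 : ℝ) 1) :
    quantileExt X t = φ t := by
  have hF : ∀ x, P.real {ω | X ω ≤ x} = volume.real (φ ⁻¹' Iic x ∩ Ico 0 1) := by
    intro x
    have h : (P.map X).real (Iic x) = ((volume.restrict (Ico (0 : ℝ) 1)).map φ).real (Iic x) := by
      rw [hX]
    rw [map_measureReal_apply (Lp.measurable_coe X) measurableSet_Iic,
      map_measureReal_apply hφ.measurable measurableSet_Iic,
      measureReal_restrict_apply (hφ.measurable measurableSet_Iic)] at h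
    exact h
  rw [quantileExt_of_mem X ht]
  -- Right-continuity keeps φ below x up to some s > t, so the sublevel set contains [0,s); this
  -- gives the strict inequality.
  have hup : ∀ x, φ t < x → t < P.real {ω | X ω ≤ x} := by
    intro x hx
    have h1 : ∀ᶠ s in 𝓝[>] t, φ s < x :=
      ((hc t ht).mono Ioi_subset_Ici_self).eventually (Iio_mem_nhds hx)
    have h2 : ∀ᶠ s in 𝓝[>] t, s < 1 := mem_nhdsWithin_of_mem_nhds (Iio_mem_nhds ht.2)
    obtain ⟨s, ⟨hs1, hs2⟩, hs3⟩ := ((h1.and h2).and self_mem_nhdsWithin).exists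
    rw [hF]
    calc t < s := hs3
      _ = volume.real (Ico 0 s) := by simp [(ht.1.trans (le_of_lt hs3))]
      _ ≤ _ := by
        refine measureReal_mono (fun u hu => ⟨?_, hu.1, hu.2.trans hs2⟩) ?_
        · exact (hφ hu.2.le).trans hs1.le
        · exact ((measure_mono inter_subset_right).trans_lt (by simp)).ne
  refine csInf_eq_of_forall_ge_of_forall_gt_exists_lt ⟨φ t + 1, hup _ (lt_add_one _)⟩
    (fun x hx => ?_) fun x hx => ?_
  · by_contra! hlt
    have h : P.real {ω | X ω ≤ x} ≤ t := by
      rw [hF]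
      calc _ ≤ volume.real (Ico 0 t) := by
            refine measureReal_mono (fun u hu => ⟨hu.2.1, ?_⟩) (by simp)
            by_contra! htu
            exact absurd (hφ htu) (not_le.2 (lt_of_le_of_lt hu.1 hlt))
        _ = t := by simp [ht.1]
    exact absurd hx (not_lt.2 h)
  · obtain ⟨y, hy, hyx⟩ := exists_between hx
    exact ⟨y, hup y hy, hyx⟩

variable [IsProbabilityMeasure P]

theorem measureReal_le_eq_cdf (X : Lp ℝ ∞ P) (x : ℝ) :
    P.real {ω | X ω ≤ x} = ProbabilityTheory.cdf (P.map X) x := by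
  have := Measure.isProbabilityMeasure_map (μ := P) (Lp.measurable_coe X).aemeasurable
  rw [ProbabilityTheory.cdf_eq_real, map_measureReal_apply (Lp.measurable_coe X) measurableSet_Iic]
  rfl

theorem measureReal_le_norm (X : Lp ℝ ∞ P) : P.real {ω | X ω ≤ ‖X‖} = 1 := by
  have h0 : P {ω | X ω ≤ ‖X‖} = 1 := by
    refine (mem_ae_iff_prob_eq_one ((Lp.measurable_coe X) measurableSet_Iic)).1 ?_
    filter_upwards [Lp.ae_abs_le_norm X] with ω hω
    exact le_of_abs_le hω
  simp [Measure.real, h0]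

theorem upperQuantile_le_norm (X : Lp ℝ ∞ P) {t : ℝ} (ht : 0 ≤ t) (h1 : t < 1) :
    upperQuantile X t ≤ ‖X‖ :=
  upperQuantile_le X ht (by rwa [measureReal_le_norm])

theorem neg_norm_le_upperQuantile (X : Lp ℝ ∞ P) {t : ℝ} (ht : 0 ≤ t) (h1 : t < 1) :
    -‖X‖ ≤ upperQuantile X t :=
  le_csInf ⟨‖X‖, by rw [mem_ofPred_eq, measureReal_le_norm]; exact h1⟩
    fun _ hy => neg_norm_le_of_measureReal_pos X ht hy

theorem lt_measureReal_of_upperQuantile_lt (X : Lp ℝ ∞ P) {t x : ℝ} (h1 : t < 1)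
    (h : upperQuantile X t < x) : t < P.real {ω | X ω ≤ x} := by
  obtain ⟨y, hy, hyx⟩ := exists_lt_of_csInf_lt
    ⟨‖X‖, by rw [mem_ofPred_eq, measureReal_le_norm]; exact h1⟩ h
  exact lt_of_lt_of_le hy (measureReal_mono fun ω hω => le_trans hω hyx.le)

theorem monotone_quantileExt (X : Lp ℝ ∞ P) : Monotone (quantileExt X) := by
  intro s t hst
  unfold quantileExt
  split_ifs with h1 h2 h2
  · refine le_of_forall_gt_imp_ge_of_dense fun x hx => ?_
    exact upperQuantile_le X (le_max_right _ _) (lt_of_le_of_lt (max_le_max_right 0 hst)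
      (lt_measureReal_of_upperQuantile_lt X (max_lt h2 one_pos) hx))
  · exact upperQuantile_le_norm X (le_max_right _ _) (max_lt h1 one_pos)
  · exact absurd (lt_of_le_of_lt hst h2) h1
  · exact le_rfl

theorem abs_quantileExt_le (X : Lp ℝ ∞ P) (t : ℝ) : |quantileExt X t| ≤ ‖X‖ := by
  unfold quantileExt
  split_ifs with h1
  · exact abs_le.2 ⟨neg_norm_le_upperQuantile X (le_max_right _ _) (max_lt h1 one_pos),
      upperQuantile_le_norm X (le_max_right _ _) (max_lt h1 one_pos)⟩
  · simp

/-- The condition t < F(x) is strict, so an x admissible at level t remains admissible at slightly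
larger levels; monotonicity gives the other bound. -/
theorem continuousWithinAt_quantileExt (X : Lp ℝ ∞ P) {t : ℝ} (ht : t ∈ Ico (0 : ℝ) 1) :
    ContinuousWithinAt (quantileExt X) (Ici t) t := by
  refine tendsto_order.2 ⟨fun y hy => ?_, fun y hy => ?_⟩
  · filter_upwards [self_mem_nhdsWithin] with s hs
    exact lt_of_lt_of_le hy (monotone_quantileExt X hs)
  · obtain ⟨x, hx, hxy⟩ := exists_between hy
    rw [quantileExt_of_mem X ht] at hx
    have h := lt_measureReal_of_upperQuantile_lt X ht.2 hx
    filter_upwards [self_mem_nhdsWithin, mem_nhdsWithin_of_mem_nhds (Iio_mem_nhds h),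
      mem_nhdsWithin_of_mem_nhds (Iio_mem_nhds ht.2)] with s hs hs' hs1
    rw [quantileExt_of_mem X ⟨ht.1.trans hs, hs1⟩]
    exact (upperQuantile_le X (ht.1.trans hs) hs').trans_lt hxy

theorem measurable_quantileExt (X : Lp ℝ ∞ P) : Measurable (quantileExt X) :=
  (monotone_quantileExt X).measurable

/-- Within [0,1), the set where the quantile is at most x lies between [0,F(x)) and [0,F(x)], so its
length is F(x). The upper inclusion uses right-continuity of F. -/
theorem map_quantileExt (X : Lp ℝ ∞ P) :
    (volume.restrict (Ico (0 : ℝ) 1)).map (quantileExt X) = P.map X := by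
  have := Measure.isProbabilityMeasure_map (μ := P) (Lp.measurable_coe X).aemeasurable
  symm
  refine Measure.ext_of_Iic _ _ fun x => ?_
  rw [Measure.map_apply (measurable_quantileExt X) measurableSet_Iic,
    Measure.restrict_apply (measurable_quantileExt X measurableSet_Iic),
    Measure.map_apply (Lp.measurable_coe X) measurableSet_Iic]
  set F : ℝ → ℝ := fun x => P.real {ω | X ω ≤ x} with hF
  have hP : P ((X : Ω → ℝ) ⁻¹' Iic x) = ENNReal.ofReal (F x) := by
    rw [hF, ofReal_measureReal]; rfl
  rw [hP]
  have hF1 : F x ≤ 1 := measureReal_le_one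
  refine le_antisymm ?_ ?_
  · calc ENNReal.ofReal (F x) = volume (Ico 0 (F x)) := by simp
      _ ≤ _ := measure_mono fun t ht => by
        have h : t ∈ Ico (0 : ℝ) 1 := ⟨ht.1, ht.2.trans_le hF1⟩
        refine ⟨?_, h⟩
        rw [mem_preimage, quantileExt_of_mem X h]
        exact upperQuantile_le X ht.1 ht.2
  · calc _ ≤ volume (Icc 0 (F x)) := measure_mono fun t ht => ⟨ht.2.1, by
        have hc : ContinuousWithinAt F (Ioi x) x := by
          have h2 := (ProbabilityTheory.cdf (P.map X)).right_continuous x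
          have h3 : F = ProbabilityTheory.cdf (P.map X) :=
            funext fun y => measureReal_le_eq_cdf X y
          rw [h3]
          exact h2.mono Ioi_subset_Ici_self
        refine ge_of_tendsto hc ?_
        filter_upwards [self_mem_nhdsWithin] with y hy
        refine (lt_measureReal_of_upperQuantile_lt X ht.2.2 ?_).le
        have := ht.1
        rw [mem_preimage, quantileExt_of_mem X ht.2] at this
        exact lt_of_le_of_lt this hy⟩
      _ = ENNReal.ofReal (F x) := by simp

/-- On a nonatomic space there is a random variable with uniform distribution on `[0,1)`. -/
theorem IsNonatomicSpace.exists_uniform (hP : IsNonatomicSpace P) :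
    ∃ V : Ω → ℝ, Measurable V ∧ P.map V = volume.restrict (Ico (0 : ℝ) 1) := by
  obtain ⟨U, hU, hcont⟩ := hP
  set F : ℝ → ℝ := fun x => P.real {ω | U ω ≤ x} with hF
  have hprob := Measure.isProbabilityMeasure_map (μ := P) hU.aemeasurable
  have hFcdf : F = ProbabilityTheory.cdf (P.map U) := by
    ext x
    rw [ProbabilityTheory.cdf_eq_real, map_measureReal_apply hU measurableSet_Iic]
    rfl
  have hmono : Monotone F := hFcdf ▸ ProbabilityTheory.monotone_cdf _
  have hbot : Tendsto F atBot (𝓝 0) := hFcdf ▸ ProbabilityTheory.tendsto_cdf_atBot _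
  have htop : Tendsto F atTop (𝓝 1) := hFcdf ▸ ProbabilityTheory.tendsto_cdf_atTop _
  have hmV : Measurable (fun ω => F (U ω)) := hcont.measurable.comp hU
  refine ⟨fun ω => F (U ω), hmV, ?_⟩
  have := Measure.isProbabilityMeasure_map (μ := P) hmV.aemeasurable
  refine Measure.ext_of_Iic _ _ fun t => ?_
  rw [Measure.map_apply hmV measurableSet_Iic, Measure.restrict_apply measurableSet_Iic]
  -- Since F is continuous with limits 0 and 1, the set where F ≤ t is a closed half-line (-∞,s]
  -- with F(s) = t.
  have key : ∀ t ∈ Ioo (0 : ℝ) 1, P {ω | F (U ω) ≤ t} = ENNReal.ofReal t := by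
    intro t ht
    have hne : {x | F x ≤ t}.Nonempty := (hbot.eventually (Iic_mem_nhds ht.1)).exists
    have hbdd : BddAbove {x | F x ≤ t} := by
      obtain ⟨y, hy⟩ := (htop.eventually (Ioi_mem_nhds ht.2)).exists
      refine ⟨y, fun x hx => ?_⟩
      by_contra! hyx
      exact absurd (hmono hyx.le) (not_le.2 (lt_of_le_of_lt hx hy))
    have hcl : IsClosed {x | F x ≤ t} := isClosed_le hcont continuous_const
    set s := sSup {x | F x ≤ t} with hs
    have hmem : F s ≤ t := hcl.csSup_mem hne hbdd
    have hiff : ∀ x, F x ≤ t ↔ x ≤ s :=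
      fun x => ⟨fun hx => le_csSup hbdd hx, fun hx => (hmono hx).trans hmem⟩
    have hFs : F s = t := by
      refine le_antisymm hmem ?_
      have h2 : ContinuousWithinAt F (Ioi s) s := hcont.continuousWithinAt
      refine ge_of_tendsto h2 ?_
      filter_upwards [self_mem_nhdsWithin] with x hx
      exact (not_le.1 ((hiff x).not.2 (not_le.2 hx))).le
    simp_rw [hiff]
    rw [← ofReal_measureReal (μ := P)]
    exact congrArg ENNReal.ofReal hFs
  change P {ω | F (U ω) ≤ t} = _
  rcases le_or_gt 1 t with h1 | h1
  · have e1 : {ω | F (U ω) ≤ t} = univ :=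
      eq_univ_of_forall fun ω => (measureReal_le_one (μ := P)).trans h1
    have e2 : Iic t ∩ Ico (0 : ℝ) 1 = Ico 0 1 :=
      inter_eq_right.2 fun x hx => hx.2.le.trans h1
    rw [e1, e2]; simp
  rcases le_or_gt t 0 with h0 | h0
  · have e2 : volume (Iic t ∩ Ico (0 : ℝ) 1) = 0 := by
      refine measure_mono_null (t := {0}) (fun x hx => ?_) (by simp)
      exact le_antisymm (le_trans hx.1 h0) hx.2.1
    rw [e2]
    refine le_antisymm (ENNReal.le_of_forall_pos_le_add fun ε hε _ => ?_) bot_le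
    -- The minimum with 1/2 keeps the level inside (0,1), where `key` applies.
    have hm : (min ε (1 / 2 : NNReal) : ℝ) ∈ Ioo (0 : ℝ) 1 := by
      constructor
      · exact lt_min hε (by norm_num)
      · exact lt_of_le_of_lt (min_le_right _ _) (by norm_num)
    calc P {ω | F (U ω) ≤ t} ≤ P {ω | F (U ω) ≤ (min ε (1 / 2 : NNReal) : ℝ)} :=
          measure_mono fun ω hω => le_trans hω (h0.trans hm.1.le)
      _ = ENNReal.ofReal (min ε (1 / 2 : NNReal) : ℝ) := key _ hm
      _ ≤ ENNReal.ofReal ε := ENNReal.ofReal_le_ofReal (min_le_left _ _)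
      _ = 0 + ε := by simp
  · have e2 : Iic t ∩ Ico (0 : ℝ) 1 = Icc 0 t := by
      ext x; simp only [mem_inter_iff, mem_Iic, mem_Ico, mem_Icc]
      exact ⟨fun h => ⟨h.2.1, h.1⟩, fun h => ⟨h.2, h.1, h.2.trans_lt h1⟩⟩
    rw [e2, key t ⟨h0, h1⟩]; simp

theorem quantileExt_smul_add_const (X : Lp ℝ ∞ P) {a : ℝ} (ha : 0 ≤ a) (c : ℝ) {t : ℝ}
    (ht : t ∈ Ico (0 : ℝ) 1) :
    quantileExt (a • X + Lp.const ∞ P c) t = a * quantileExt X t + c := by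
  refine quantileExt_eq_of_map_eq _ (φ := fun t => a * quantileExt X t + c)
    (((monotone_quantileExt X).const_mul ha).add_const c)
    (fun s hs => (continuousWithinAt_const.mul (continuousWithinAt_quantileExt X hs)).add
      continuousWithinAt_const) ?_ ht
  have hm : Measurable fun x : ℝ => a * x + c := by fun_prop
  have h1 : (a • X + Lp.const ∞ P c : Lp ℝ ∞ P) =ᵐ[P] (fun x => a * x + c) ∘ X := by
    filter_upwards [Lp.coeFn_add (a • X) (Lp.const ∞ P c), Lp.coeFn_smul a X,
      Lp.coeFn_const ∞ P c] with ω h1 h2 h3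
    rw [h1, Pi.add_apply, h2, h3]; rfl
  rw [Measure.map_congr h1, ← Measure.map_map hm (Lp.measurable_coe X), ← map_quantileExt,
    Measure.map_map hm (measurable_quantileExt X)]
  rfl

/-- With V uniform on [0,1), take q_X(V) and q_Y(V). Both increase with V, and their mixture is a
right-continuous increasing function of V, hence has that function as its quantile. -/
theorem exists_comonotonic_copies (hP : IsNonatomicSpace P) (X Y : Lp ℝ ∞ P) :
    ∃ X' Y' : Lp ℝ ∞ P, Comonotonic X' Y' ∧
      (∀ t ∈ Ico (0 : ℝ) 1, quantileExt X' t = quantileExt X t) ∧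
      (∀ t ∈ Ico (0 : ℝ) 1, quantileExt Y' t = quantileExt Y t) ∧
      ∀ a : ℝ, 0 ≤ a → a ≤ 1 → ∀ t ∈ Ico (0 : ℝ) 1, quantileExt (a • X' + (1 - a) • Y') t =
        a * quantileExt X t + (1 - a) * quantileExt Y t := by
  obtain ⟨V, hV, hmap⟩ := hP.exists_uniform
  have hmem : ∀ Z : Lp ℝ ∞ P, MemLp (fun ω => quantileExt Z (V ω)) ∞ P := fun Z =>
    memLp_top_of_bound ((measurable_quantileExt Z).comp hV).aestronglyMeasurable ‖Z‖
      (Eventually.of_forall fun ω => abs_quantileExt_le Z _)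
  have hae : ∀ Z, (hmem Z).toLp _ =ᵐ[P] fun ω => quantileExt Z (V ω) :=
    fun Z => (hmem Z).coeFn_toLp
  have hlaw : ∀ (W : Lp ℝ ∞ P) (φ : ℝ → ℝ), Monotone φ → W =ᵐ[P] (fun ω => φ (V ω)) →
      P.map W = (volume.restrict (Ico (0 : ℝ) 1)).map φ := by
    intro W φ hφ hW
    rw [Measure.map_congr hW, ← hmap, Measure.map_map hφ.measurable hV]
    rfl
  refine ⟨(hmem X).toLp _, (hmem Y).toLp _, ?_, fun t ht => ?_, fun t ht => ?_,
    fun a h0 h1 t ht => ?_⟩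
  -- Elements of L^∞ have fixed representatives, so comonotonicity is checked on a full-measure
  -- measurable set where they agree with the explicit functions of V.
  · obtain ⟨s, hs, hsm, hsp⟩ := ((hae X).and (hae Y)).exists_measurable_mem
    refine ⟨s, hsm, ?_, fun ω hω ω' hω' => ?_⟩
    · exact (mem_ae_iff_prob_eq_one hsm).1 hs
    · rw [(hsp ω hω).1, (hsp ω hω).2, (hsp ω' hω').1, (hsp ω' hω').2]
      rcases le_total (V ω) (V ω') with h | h
      · exact mul_nonneg_of_nonpos_of_nonpos (sub_nonpos.2 (monotone_quantileExt X h))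
          (sub_nonpos.2 (monotone_quantileExt Y h))
      · exact mul_nonneg (sub_nonneg.2 (monotone_quantileExt X h))
          (sub_nonneg.2 (monotone_quantileExt Y h))
  · exact quantileExt_eq_of_map_eq _ (monotone_quantileExt X)
      (fun s hs => continuousWithinAt_quantileExt X hs)
      (hlaw _ _ (monotone_quantileExt X) (hae X)) ht
  · exact quantileExt_eq_of_map_eq _ (monotone_quantileExt Y)
      (fun s hs => continuousWithinAt_quantileExt Y hs)
      (hlaw _ _ (monotone_quantileExt Y) (hae Y)) ht
  · have hm : Monotone fun t => a * quantileExt X t + (1 - a) * quantileExt Y t :=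
      ((monotone_quantileExt X).const_mul h0).add
        ((monotone_quantileExt Y).const_mul (sub_nonneg.2 h1))
    refine quantileExt_eq_of_map_eq _ hm
      (fun s hs => (continuousWithinAt_const.mul (continuousWithinAt_quantileExt X hs)).add
        (continuousWithinAt_const.mul (continuousWithinAt_quantileExt Y hs)))
      (hlaw _ _ hm ?_) ht
    filter_upwards [Lp.coeFn_add (a • (hmem X).toLp _) ((1 - a) • (hmem Y).toLp _),
      Lp.coeFn_smul a ((hmem X).toLp _), Lp.coeFn_smul (1 - a) ((hmem Y).toLp _),
      hae X, hae Y] with ω h1 h2 h3 h4 h5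
    rw [h1, Pi.add_apply, h2, h3, Pi.smul_apply, Pi.smul_apply, h4, h5]; rfl

end Quantiles

/-! ### Second-order dominance from integrated quantiles -/

section StochasticDominance

/-- If all the integrals of `D` over initial intervals are nonpositive, then so is the integral
of `D` against a nonnegative decreasing weight. -/
theorem integral_antitone_mul_nonpos {G D : ℝ → ℝ} {C : ℝ} (hG : Antitone G) (hG0 : ∀ t, 0 ≤ G t)
    (hD : Measurable D) (hC : ∀ t, |D t| ≤ C)
    (h : ∀ s ∈ Icc (0 : ℝ) 1, ∫ t in (0 : ℝ)..s, D t ≤ 0) :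
    ∫ t in Ico (0 : ℝ) 1, G t * D t ≤ 0 := by
  -- Layer-cake decomposition: G(t) is the integral over levels u of the indicator of u < G(t).
  have e1 : ∀ t ∈ Ico (0 : ℝ) 1,
      ∫ u in Ioc 0 (G 0), (Iio (G t)).indicator (fun _ => D t) u = G t * D t := by
    intro t ht
    rw [setIntegral_indicator measurableSet_Iio, setIntegral_const, smul_eq_mul]
    congr 1
    have h1 : Ioo 0 (G t) ⊆ Ioc 0 (G 0) ∩ Iio (G t) :=
      fun u hu => ⟨⟨hu.1, hu.2.le.trans (hG ht.1)⟩, hu.2⟩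
    have h2 : Ioc 0 (G 0) ∩ Iio (G t) ⊆ Ioo 0 (G t) := fun u hu => ⟨hu.1.1, hu.2⟩
    rw [subset_antisymm h2 h1, Real.volume_real_Ioo_of_le (hG0 t), sub_zero]
  have hmeas : Measurable fun p : ℝ × ℝ => (Iio (G p.1)).indicator (fun _ => D p.1) p.2 := by
    have : (fun p : ℝ × ℝ => (Iio (G p.1)).indicator (fun _ => D p.1) p.2) =
        {p : ℝ × ℝ | p.2 < G p.1}.indicator fun p => D p.1 := by
      ext p; simp [indicator]
    rw [this]
    exact (hD.comp measurable_fst).indicator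
      (measurableSet_lt measurable_snd (hG.measurable.comp measurable_fst))
  rw [← setIntegral_congr_fun measurableSet_Ico e1, integral_integral_swap]
  · refine integral_nonpos fun u => ?_
    have e2 : (fun t => (Iio (G t)).indicator (fun _ => D t) u) =
        {t | u < G t}.indicator D := by
      ext t; simp [indicator]
    have hS : MeasurableSet {t | u < G t} := measurableSet_lt measurable_const hG.measurable
    simp only [e2, Pi.zero_apply]
    rw [setIntegral_indicator hS]
    set S := Ico (0 : ℝ) 1 ∩ {t | u < G t} with hSdef
    rcases S.eq_empty_or_nonempty with hne | hne
    · simp [hne]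
    have hbdd : BddAbove S := ⟨1, fun t ht => ht.1.2.le⟩
    have h0 : 0 ≤ sSup S := by
      obtain ⟨t, ht⟩ := hne
      exact ht.1.1.trans (le_csSup hbdd ht)
    have h1 : sSup S ≤ 1 := csSup_le hne fun t ht => ht.1.2.le
    -- G is decreasing, so its superlevel sets in [0,1) are initial intervals up to an endpoint; the
    -- hypothesis `h` then applies level by level.
    have hae : S =ᵐ[volume] Ioc 0 (sSup S) := by
      refine Filter.EventuallyLE.antisymm ?_ (Ioo_ae_eq_Ioc.symm.le.trans ?_)
      · have : S ≤ᵐ[volume] Icc 0 (sSup S) :=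
          LE.le.eventuallyLE fun t ht => ⟨ht.1.1, le_csSup hbdd ht⟩
        exact this.trans Ioc_ae_eq_Icc.symm.le
      · refine LE.le.eventuallyLE fun t ht => ?_
        obtain ⟨s, hs, hts⟩ := exists_lt_of_lt_csSup hne ht.2
        exact ⟨⟨ht.1.le, hts.trans hs.1.2⟩, lt_of_lt_of_le hs.2 (hG hts.le)⟩
    rw [setIntegral_congr_set hae, ← intervalIntegral.integral_of_le h0]
    exact h _ ⟨h0, h1⟩
  · refine Integrable.of_bound (C := C) hmeas.aestronglyMeasurable
      (Eventually.of_forall fun p => ?_)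
    exact (norm_indicator_le_norm_self (fun _ => D p.1) p.2).trans (hC p.1)

/-- The right derivative of f works: concavity makes it decreasing, and monotonicity of f makes it
nonnegative. -/
theorem ConcaveOn.exists_antitone_supergradient {f : ℝ → ℝ} (hf : ConcaveOn ℝ univ f)
    (hm : Monotone f) :
    ∃ g : ℝ → ℝ, Antitone g ∧ (∀ x, 0 ≤ g x) ∧ ∀ x y, f y ≤ f x + g x * (y - x) := by
  have hc : ConvexOn ℝ univ (-f) := hf.neg
  have hi : ∀ x : ℝ, x ∈ interior (univ : Set ℝ) := by simp
  have hsup : ∀ x y, f y ≤ f x + -derivWithin (-f) (Ioi x) x * (y - x) := by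
    intro x y
    rcases lt_trichotomy x y with h | rfl | h
    · have h1 := hc.rightDeriv_le_slope_of_mem_interior (hi x) (mem_univ y) h
      rw [slope_def_field, le_div_iff₀ (sub_pos.2 h)] at h1
      simp only [Pi.neg_apply] at h1
      linarith
    · simp
    · have h1 := hc.slope_le_leftDeriv_of_mem_interior (mem_univ y) (hi x) h
      have h2 := h1.trans (hc.leftDeriv_le_rightDeriv_of_mem_interior (hi x))
      rw [slope_def_field, div_le_iff₀ (sub_pos.2 h)] at h2
      simp only [Pi.neg_apply] at h2
      linarith
  refine ⟨fun x => -derivWithin (-f) (Ioi x) x, ?_, fun x => ?_, hsup⟩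
  · intro x y hxy
    exact neg_le_neg (hc.monotoneOn_rightDeriv (hi x) (hi y) hxy)
  · have h1 := hsup x (x - 1)
    have h2 := hsup x (x + 1)
    have h3 := hm (show x ≤ x + 1 by linarith)
    simp only [add_sub_cancel_left] at h2
    linarith

variable {Ω : Type*} [MeasurableSpace Ω] {P : Measure Ω} [IsProbabilityMeasure P]

theorem integral_comp_eq_integral_quantileExt (X : Lp ℝ ∞ P) {f : ℝ → ℝ} (hf : Measurable f) :
    ∫ ω, f (X ω) ∂P = ∫ t in Ico (0 : ℝ) 1, f (quantileExt X t) := by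
  rw [← integral_map (Lp.measurable_coe X).aemeasurable hf.aestronglyMeasurable,
    ← map_quantileExt, integral_map (measurable_quantileExt X).aemeasurable hf.aestronglyMeasurable]

/-- The supergradient inequality gives f(q_Y) ≤ f(q_X) + g(q_X)(q_Y - q_X). The weight g(q_X) is
nonnegative and decreasing, so the last term has nonpositive integral. -/
theorem ssDominates_of_integral_quantileExt_le {X Y : Lp ℝ ∞ P}
    (h : ∀ s ∈ Icc (0 : ℝ) 1,
      ∫ t in (0 : ℝ)..s, quantileExt Y t ≤ ∫ t in (0 : ℝ)..s, quantileExt X t) :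
    SSDominates X Y := by
  intro f hm hf
  rw [integral_comp_eq_integral_quantileExt X hm.measurable,
    integral_comp_eq_integral_quantileExt Y hm.measurable]
  obtain ⟨g, hg, hg0, hsup⟩ := hf.exists_antitone_supergradient hm
  have hqX := monotone_quantileExt X
  have hqY := monotone_quantileExt Y
  have hbound : ∀ {F : ℝ → ℝ} (Z : Lp ℝ ∞ P), Monotone F →
      Integrable (fun t => F (quantileExt Z t)) (volume.restrict (Ico (0 : ℝ) 1)) := by
    intro F Z hF
    refine Integrable.of_bound (C := max |F (-‖Z‖)| |F ‖Z‖|)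
      (hF.measurable.comp (measurable_quantileExt Z)).aestronglyMeasurable
      (Eventually.of_forall fun t => ?_)
    have hq := abs_le.1 (abs_quantileExt_le Z t)
    exact abs_le_max_abs_abs (hF hq.1) (hF hq.2)
  have hD : Measurable fun t => quantileExt Y t - quantileExt X t :=
    (measurable_quantileExt Y).sub (measurable_quantileExt X)
  have hDb : ∀ t, |quantileExt Y t - quantileExt X t| ≤ ‖Y‖ + ‖X‖ := fun t =>
    (abs_sub _ _).trans (add_le_add (abs_quantileExt_le Y t) (abs_quantileExt_le X t))
  have hG : Antitone fun t => g (quantileExt X t) := fun s t hst => hg (hqX hst)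
  have key := integral_antitone_mul_nonpos (G := fun t => g (quantileExt X t)) hG
    (fun t => hg0 _) hD hDb fun s hs => by
      rw [intervalIntegral.integral_sub hqY.intervalIntegrable hqX.intervalIntegrable]
      exact sub_nonpos.2 (h s hs)
  have hint : Integrable (fun t => g (quantileExt X t) * (quantileExt Y t - quantileExt X t))
      (volume.restrict (Ico (0 : ℝ) 1)) := by
    have h1 : Integrable (fun t => g (quantileExt X t)) (volume.restrict (Ico (0 : ℝ) 1)) := by
      have := (hbound X (F := fun x => -g x) hg.neg).neg
      simpa using this
    exact h1.mul_bdd hD.aestronglyMeasurable (Eventually.of_forall hDb)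
  have hle : ∫ t in Ico (0 : ℝ) 1, f (quantileExt Y t) ≤ ∫ t in Ico (0 : ℝ) 1,
      (f (quantileExt X t) + g (quantileExt X t) * (quantileExt Y t - quantileExt X t)) :=
    integral_mono (hbound Y hm) ((hbound X hm).add hint) fun t => hsup _ _
  rw [integral_add (hbound X hm) hint] at hle
  linarith

end StochasticDominance

/-! ### The measure of J w, and Fubini for its density -/

namespace UnitDF

theorem tendsto_atBot (w : UnitDF) : Tendsto w.toStieltjesFunction atBot (𝓝 0) := by
  refine tendsto_const_nhds.congr' ?_
  filter_upwards [eventually_lt_atBot (0 : ℝ)] with t ht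
  exact (w.eq_zero' t ht).symm

theorem measure_Iic (w : UnitDF) (t : ℝ) : w.measure (Iic t) = ENNReal.ofReal (w.toFun t) := by
  have := StieltjesFunction.measure_Iic w.toStieltjesFunction w.tendsto_atBot t
  rwa [sub_zero] at this

theorem measureReal_singleton_zero (w : UnitDF) : w.measure.real {0} = w.toFun 0 := by
  have h : Function.leftLim w.toStieltjesFunction 0 = 0 := by
    refine leftLim_eq_of_tendsto (tendsto_const_nhds.congr' ?_)
    filter_upwards [self_mem_nhdsWithin] with t ht
    exact (w.eq_zero' t ht).symm
  rw [Measure.real, UnitDF.measure, StieltjesFunction.measure_singleton, h, sub_zero]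
  exact ENNReal.toReal_ofReal (w.nonneg 0)

/-- The measure of a mixture of distribution functions is the mixture of the measures. -/
theorem measure_eq_of_mix {w w₁ w₂ : UnitDF} {a : ℝ} (h₀ : 0 ≤ a) (h₁ : a ≤ 1)
    (h : ∀ t, w.toFun t = a * w₁.toFun t + (1 - a) * w₂.toFun t) :
    w.measure = ENNReal.ofReal a • w₁.measure + ENNReal.ofReal (1 - a) • w₂.measure := by
  have := w.isProbabilityMeasure
  refine Measure.ext_of_Iic _ _ fun t => ?_
  have h1 := sub_nonneg.2 h₁
  simp only [Measure.add_apply, Measure.smul_apply, smul_eq_mul, measure_Iic, h t]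
  rw [ENNReal.ofReal_add (mul_nonneg h₀ (w₁.nonneg t)) (mul_nonneg h1 (w₂.nonneg t)),
    ENNReal.ofReal_mul h₀, ENNReal.ofReal_mul h1]

theorem setIntegral_of_mix {w w₁ w₂ : UnitDF} {a : ℝ} (h₀ : 0 ≤ a) (h₁ : a ≤ 1)
    (h : ∀ t, w.toFun t = a * w₁.toFun t + (1 - a) * w₂.toFun t) {s : Set ℝ} {g : ℝ → ℝ}
    (hg₁ : IntegrableOn g s w₁.measure) (hg₂ : IntegrableOn g s w₂.measure) :
    ∫ t in s, g t ∂w.measure =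
      a * (∫ t in s, g t ∂w₁.measure) + (1 - a) * ∫ t in s, g t ∂w₂.measure := by
  rw [measure_eq_of_mix h₀ h₁ h, Measure.restrict_add, Measure.restrict_smul,
    Measure.restrict_smul, integral_add_measure (hg₁.smul_measure ENNReal.ofReal_ne_top)
    (hg₂.smul_measure ENNReal.ofReal_ne_top), integral_smul_measure, integral_smul_measure,
    ENNReal.toReal_ofReal h₀, ENNReal.toReal_ofReal (sub_nonneg.2 h₁), smul_eq_mul, smul_eq_mul]

/-- The mixture `a w₁ + (1 - a) w₂` in `𝒲`. -/
def mix (a : ℝ) (h₀ : 0 ≤ a) (h₁ : a ≤ 1) (w₁ w₂ : UnitDF) : UnitDF where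
  toFun t := a * w₁.toFun t + (1 - a) * w₂.toFun t
  mono' := (w₁.mono'.const_mul h₀).add (w₂.mono'.const_mul (sub_nonneg.2 h₁))
  right_continuous' x := (continuousWithinAt_const.mul (w₁.right_continuous' x)).add
    (continuousWithinAt_const.mul (w₂.right_continuous' x))
  eq_zero' t ht := by rw [w₁.eq_zero' t ht, w₂.eq_zero' t ht]; ring
  eq_one' t ht := by rw [w₁.eq_one' t ht, w₂.eq_one' t ht]; ring

theorem _root_.ConcaveDF.ext_toFun {φ ψ : ConcaveDF} (h : ∀ t, φ.toFun t = ψ.toFun t) :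
    φ = ψ := by
  rcases φ with ⟨⟨⟨f, _, _⟩, _, _⟩, _⟩
  rcases ψ with ⟨⟨⟨g, _, _⟩, _, _⟩, _⟩
  obtain rfl : f = g := funext h
  rfl

theorem J_mix (a : ℝ) (h₀ : 0 ≤ a) (h₁ : a ≤ 1) (w₁ w₂ : UnitDF) :
    (mix a h₀ h₁ w₁ w₂).J = ConcaveDF.mix a h₀ h₁ w₁.J w₂.J := by
  refine ConcaveDF.ext_toFun fun t => ?_
  change (if t < 0 then 0 else (mix a h₀ h₁ w₁ w₂).concaveFun (min t 1)) =
    a * (if t < 0 then 0 else w₁.concaveFun (min t 1)) +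
      (1 - a) * (if t < 0 then 0 else w₂.concaveFun (min t 1))
  split_ifs with ht
  · ring
  have h0 : 0 ≤ min t 1 := le_min (not_lt.1 ht) zero_le_one
  have h1 : min t 1 ≤ 1 := min_le_right _ _
  rw [concaveFun_eq _ h0 h1, concaveFun_eq _ h0 h1, concaveFun_eq _ h0 h1,
    setIntegral_of_mix h₀ h₁ (fun _ => rfl) (w₁.integrable_kernel h0) (w₂.integrable_kernel h0)]
  change a * w₁.toFun 0 + (1 - a) * w₂.toFun 0 + _ = _
  ring

theorem density_nonneg (w : UnitDF) {u : ℝ} (hu : 0 ≤ u) : 0 ≤ w.density u :=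
  setIntegral_nonneg measurableSet_Ioc fun _ hs => (inv_pos.2 (hu.trans_lt hs.1)).le

theorem density_eq (w : UnitDF) {u : ℝ} (hu : 0 < u) :
    w.density u = ∫ s in Ioc (0 : ℝ) 1, (Iio s).indicator (fun _ => s⁻¹) u ∂w.measure := by
  have : (fun s : ℝ => (Iio s).indicator (fun _ => s⁻¹) u) =
      (Ioi u).indicator (fun s => s⁻¹) := by
    ext s; simp [indicator]
  rw [this, setIntegral_indicator measurableSet_Ioi, density]
  congr 2
  ext x; simp only [mem_inter_iff, mem_Ioc, mem_Ioi]
  exact ⟨fun h => ⟨⟨hu.trans h.1, h.2⟩, h.1⟩, fun h => ⟨h.2, h.1.2⟩⟩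

theorem setIntegral_indicator_Iio_inv {s : ℝ} (hs : s ∈ Ioc (0 : ℝ) 1) (g : ℝ → ℝ) :
    ∫ u in Ioc 0 1, (Iio s).indicator (fun _ => s⁻¹) u * g u = s⁻¹ * ∫ u in (0 : ℝ)..s, g u := by
  have e : (fun u => (Iio s).indicator (fun _ => s⁻¹) u * g u) =
      (Iio s).indicator fun u => s⁻¹ * g u := by
    ext u; simp [indicator]
  rw [e, setIntegral_indicator measurableSet_Iio, integral_const_mul,
    intervalIntegral.integral_of_le hs.1.le, ← integral_Ioc_eq_integral_Ioo.symm]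
  congr 3
  ext x; simp only [mem_inter_iff, mem_Ioc, mem_Iio, mem_Ioo]
  exact ⟨fun h => ⟨h.1.1, h.2⟩, fun h => ⟨⟨h.1, h.2.le.trans hs.2⟩, h.2⟩⟩

/-- The factor 1/s is unbounded near 0, but integrating it over u in (0,s) first gives exactly 1.
This licenses the exchange of integrals in `setIntegral_J`. -/
theorem integrable_kernel_prod (w : UnitDF) :
    Integrable (fun p : ℝ × ℝ => (Iio p.2).indicator (fun _ => p.2⁻¹) p.1)
      ((volume.restrict (Ioc 0 1)).prod (w.measure.restrict (Ioc 0 1))) := by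
  have := w.isProbabilityMeasure
  have hmeas : Measurable (fun p : ℝ × ℝ => (Iio p.2).indicator (fun _ => p.2⁻¹) p.1) := by
    have : (fun p : ℝ × ℝ => (Iio p.2).indicator (fun _ => p.2⁻¹) p.1) =
        {p : ℝ × ℝ | p.1 < p.2}.indicator (fun p => p.2⁻¹) := by
      ext p; simp [indicator]
    rw [this]
    exact measurable_snd.inv.indicator (measurableSet_lt measurable_fst measurable_snd)
  refine (integrable_prod_iff' hmeas.aestronglyMeasurable).2 ⟨?_, ?_⟩
  · exact Eventually.of_forall fun s => (integrable_const s⁻¹).indicator measurableSet_Iio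
  · refine Integrable.of_bound (C := 1) ?_ ?_
    · exact (hmeas.norm.stronglyMeasurable.integral_prod_left').aestronglyMeasurable
    · filter_upwards [ae_restrict_mem measurableSet_Ioc] with s hs
      have h1 : ∀ u, ‖(Iio s).indicator (fun _ => s⁻¹) u‖ =
          (Iio s).indicator (fun _ => s⁻¹) u * 1 := fun u => by
        rw [mul_one]
        exact Real.norm_of_nonneg (indicator_nonneg (fun _ _ => (inv_pos.2 hs.1).le) u)
      simp only [h1]
      rw [setIntegral_indicator_Iio_inv hs]
      simp [hs.1.ne']

theorem integrableOn_density (w : UnitDF) : IntegrableOn w.density (Ioc 0 1) := by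
  have := w.isProbabilityMeasure
  refine w.integrable_kernel_prod.integral_prod_left.congr ?_
  filter_upwards [ae_restrict_mem measurableSet_Ioc] with u hu
  exact (w.density_eq hu.1).symm

/-- The measure `J w` has the atom `w 0` at `0` and the density `∫_{(t,1]} s⁻¹ dw(s)`. -/
theorem measure_J (w : UnitDF) : w.J.measure = ENNReal.ofReal (w.toFun 0) • Measure.dirac 0 +
    (volume.restrict (Ioc 0 1)).withDensity fun u => ENNReal.ofReal (w.density u) := by
  have := w.J.toUnitDF.isProbabilityMeasure
  change w.J.toUnitDF.measure = _
  refine Measure.ext_of_Iic _ _ fun t => ?_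
  rw [measure_Iic, Measure.add_apply, Measure.smul_apply, withDensity_apply _ measurableSet_Iic,
    Measure.restrict_restrict measurableSet_Iic, Measure.dirac_apply' _ measurableSet_Iic]
  change ENNReal.ofReal (if t < 0 then 0 else w.concaveFun (min t 1)) = _
  split_ifs with ht
  · have h1 : Iic t ∩ Ioc (0 : ℝ) 1 = ∅ := by
      ext x; simp only [mem_inter_iff, mem_Iic, mem_Ioc, mem_empty_iff_false, iff_false]
      intro h; linarith [h.1, h.2.1]
    simp [h1, ht]
  · have h0 : 0 ≤ min t 1 := le_min (not_lt.1 ht) zero_le_one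
    have h1 : Iic t ∩ Ioc (0 : ℝ) 1 = Ioc 0 (min t 1) := by
      ext x; simp only [mem_inter_iff, mem_Iic, mem_Ioc, le_min_iff]
      tauto
    have hsub : Ioc 0 (min t 1) ⊆ Ioc (0 : ℝ) 1 := Ioc_subset_Ioc_right (min_le_right _ _)
    have hnn : 0 ≤ᵐ[volume.restrict (Ioc 0 (min t 1))] w.density := by
      filter_upwards [ae_restrict_mem measurableSet_Ioc] with u hu
      exact w.density_nonneg hu.1.le
    rw [h1, ← ofReal_integral_eq_lintegral_ofReal (w.integrableOn_density.mono_set hsub) hnn,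
      concaveFun, intervalIntegral.integral_of_le h0, ENNReal.ofReal_add (w.nonneg 0)
        (integral_nonneg_of_ae hnn)]
    simp [not_lt.1 ht]

/-- Makes the limit convention for the quantile at level 1 irrelevant to integrals against J w. -/
theorem measure_J_singleton_one (w : UnitDF) : w.J.measure {1} = 0 := by
  rw [measure_J, Measure.add_apply, Measure.smul_apply, Measure.dirac_apply' _ (by simp)]
  simp only [mem_singleton_iff, zero_ne_one, not_false_eq_true, indicator_of_notMem, smul_zero,
    zero_add]
  exact ((withDensity_absolutelyContinuous _ _).trans Measure.restrict_le_self.absolutelyContinuous)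
    (by simp)

theorem setIntegral_J (w : UnitDF) {g : ℝ → ℝ} {C : ℝ} (hg : Measurable g)
    (hC : ∀ t, |g t| ≤ C) :
    ∫ t in Icc 0 1, g t ∂w.J.measure =
      w.toFun 0 * g 0 + ∫ s in Ioc (0 : ℝ) 1, (s⁻¹ * ∫ u in (0 : ℝ)..s, g u) ∂w.measure := by
  have := w.isProbabilityMeasure
  have hJ : IsProbabilityMeasure w.J.measure := w.J.toUnitDF.isProbabilityMeasure
  have hint : Integrable g (w.J.measure.restrict (Icc 0 1)) :=
    Integrable.of_bound (C := C) hg.aestronglyMeasurable (Eventually.of_forall hC)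
  have hd : AEMeasurable (fun u => ENNReal.ofReal (w.density u)) (volume.restrict (Ioc 0 1)) :=
    w.integrableOn_density.aemeasurable.ennreal_ofReal
  rw [measure_J, Measure.restrict_add] at hint ⊢
  rw [integral_add_measure hint.left_of_add_measure hint.right_of_add_measure]
  congr 1
  · rw [Measure.restrict_smul, restrict_dirac' measurableSet_Icc, if_pos (by simp),
      integral_smul_measure, integral_dirac, ENNReal.toReal_ofReal (w.nonneg 0), smul_eq_mul]
  · rw [restrict_withDensity measurableSet_Icc, Measure.restrict_restrict measurableSet_Icc,
      inter_eq_right.2 Ioc_subset_Icc_self,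
      integral_withDensity_eq_integral_toReal_smul₀ hd (by simp)]
    have e1 : ∫ u in Ioc 0 1, (ENNReal.ofReal (w.density u)).toReal • g u =
        ∫ u in Ioc 0 1, ∫ s in Ioc (0 : ℝ) 1,
          (Iio s).indicator (fun _ => s⁻¹) u * g u ∂w.measure := by
      refine setIntegral_congr_fun measurableSet_Ioc fun u hu => ?_
      rw [ENNReal.toReal_ofReal (w.density_nonneg hu.1.le), density_eq w hu.1, smul_eq_mul,
        integral_mul_const]
    rw [e1, integral_integral_swap]
    · refine setIntegral_congr_fun measurableSet_Ioc fun s hs => ?_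
      exact setIntegral_indicator_Iio_inv hs g
    · exact w.integrable_kernel_prod.mul_bdd (c := C)
        (hg.comp measurable_fst).aestronglyMeasurable (Eventually.of_forall fun p => hC p.1)

end UnitDF

/-! ### Average value at risk curves -/

section AverageVaR

variable {Ω : Type*} [MeasurableSpace Ω] {P : Measure Ω}

/-- The average value at risk `s⁻¹ ∫_0^s VaR_t(X) dt`, with value `VaR_0(X)` at `s = 0`. -/
noncomputable def avgVaR (X : Lp ℝ ∞ P) (s : ℝ) : ℝ :=
  if s = 0 then -quantileExt X 0 else -(s⁻¹ * ∫ u in (0 : ℝ)..s, quantileExt X u)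

variable [IsProbabilityMeasure P]

/-- At 0 this is the right derivative of the primitive of q_X, which exists and equals q_X(0) by
right-continuity. Elsewhere the primitive is continuous. -/
theorem continuousOn_avgVaR (X : Lp ℝ ∞ P) : ContinuousOn (avgVaR X) (Icc 0 1) := by
  intro s hs
  have hmono := monotone_quantileExt X
  rcases hs.1.eq_or_lt with rfl | h0
  · have hd : HasDerivWithinAt (fun s => ∫ u in (0 : ℝ)..s, quantileExt X u) (quantileExt X 0)
        (Ici 0) 0 :=
      intervalIntegral.integral_hasDerivWithinAt_right (by simp)
        ((measurable_quantileExt X).stronglyMeasurable.stronglyMeasurableAtFilter)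
        ((continuousWithinAt_quantileExt X (by simp)).mono Ioi_subset_Ici_self)
    rw [hasDerivWithinAt_iff_tendsto_slope] at hd
    have h1 : ContinuousWithinAt (avgVaR X) (Icc 0 1 \ {0}) 0 := by
      have h2 : avgVaR X 0 = -quantileExt X 0 := if_pos rfl
      rw [ContinuousWithinAt, h2]
      refine (hd.neg.mono_left (nhdsWithin_mono _
        (sdiff_subset_sdiff_left Icc_subset_Ici_self))).congr' ?_
      filter_upwards [self_mem_nhdsWithin] with s hs
      rw [avgVaR, if_neg (show s ≠ 0 from hs.2), slope_def_field, intervalIntegral.integral_same,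
          sub_zero, sub_zero, div_eq_inv_mul]
    exact continuousWithinAt_sdiff_self.1 h1
  · refine ContinuousAt.continuousWithinAt ?_
    have hc : Continuous fun s => ∫ u in (0 : ℝ)..s, quantileExt X u :=
      intervalIntegral.continuous_primitive (fun _ _ => hmono.intervalIntegrable) 0
    have h1 : ContinuousAt (fun s => -(s⁻¹ * ∫ u in (0 : ℝ)..s, quantileExt X u)) s :=
      ((continuousAt_inv₀ h0.ne').mul hc.continuousAt).neg
    refine h1.congr ?_
    filter_upwards [Ioi_mem_nhds h0] with u hu
    exact (if_neg (ne_of_gt hu)).symm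

/-- Converts between 𝒲 and Ψ: the atom at 0 matches the value of `avgVaR` there, and Fubini on (0,1]
averages the quantile over (0,s). -/
theorem setIntegral_VaR_J (w : UnitDF) (X : Lp ℝ ∞ P) :
    ∫ t in Icc (0 : ℝ) 1, VaR t X ∂w.J.measure = ∫ s in Icc (0 : ℝ) 1, avgVaR X s ∂w.measure := by
  have := w.isProbabilityMeasure
  have h1 : ∀ᵐ t ∂w.J.measure.restrict (Icc 0 1), VaR t X = -quantileExt X t := by
    have h2 : ∀ᵐ t ∂w.J.measure, t ≠ 1 := by
      rw [ae_iff]; simpa using w.measure_J_singleton_one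
    filter_upwards [ae_restrict_mem measurableSet_Icc, ae_restrict_of_ae h2] with t ht ht1
    have ht' : t ∈ Ico (0 : ℝ) 1 := ⟨ht.1, lt_of_le_of_ne ht.2 ht1⟩
    rw [quantileExt_of_mem X ht', VaR, quantile, if_pos ht'.2]
  have hint : IntegrableOn (avgVaR X) (Icc 0 1) w.measure :=
    (continuousOn_avgVaR X).integrableOn_compact isCompact_Icc
  rw [integral_congr_ae h1, w.setIntegral_J (g := fun t => -quantileExt X t)
      (measurable_quantileExt X).neg (C := ‖X‖)
    (fun t => (abs_neg _).trans_le (abs_quantileExt_le X t)),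
    ← Ioc_insert_left zero_le_one, insert_eq, setIntegral_union (by simp) measurableSet_Ioc
    (hint.mono_set (by simp)) (hint.mono_set Ioc_subset_Icc_self), integral_singleton,
    w.measureReal_singleton_zero]
  congr 1
  · simp [avgVaR]
  · refine setIntegral_congr_fun measurableSet_Ioc fun s hs => ?_
    simp only [avgVaR, if_neg hs.1.ne', intervalIntegral.integral_neg, mul_neg]

/-- The point 1 is split off because `quantileExt` takes an artificial value there. -/
theorem integrableOn_VaR (ψ : ConcaveDF) (X : Lp ℝ ∞ P) :
    IntegrableOn (fun t => VaR t X) (Icc 0 1) ψ.measure := by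
  have : IsProbabilityMeasure ψ.measure := ψ.toUnitDF.isProbabilityMeasure
  rw [← Ico_insert_right zero_le_one, insert_eq, integrableOn_union]
  refine ⟨integrableOn_singleton, ?_⟩
  have h1 : IntegrableOn (fun t => -quantileExt X t) (Ico 0 1) ψ.measure :=
    Integrable.of_bound (C := ‖X‖) (measurable_quantileExt X).neg.aestronglyMeasurable
      (Eventually.of_forall fun t => (norm_neg _).trans_le (abs_quantileExt_le X t))
  refine h1.congr_fun (fun t ht => ?_) measurableSet_Ico
  simp only [quantileExt_of_mem X ht, VaR, quantile, if_pos ht.2]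

end AverageVaR

/-! ### Riesz representation and compactness of 𝒲 -/

namespace UnitDF

/-- The restriction to `[0,1]` of a function continuous on `[0,1]`. -/
def toUnitC (f : ℝ → ℝ) (hf : ContinuousOn f (Icc 0 1)) : C(Icc (0 : ℝ) 1, ℝ) :=
  ⟨(Icc (0 : ℝ) 1).domRestrict f, hf.domRestrict⟩

/-- Riesz representation of positive normalized functionals on `C[0,1]` by distribution
functions. -/
theorem exists_setIntegral_eq (ℓ : C(Icc (0 : ℝ) 1, ℝ) →ₗ[ℝ] ℝ) (hpos : ∀ f, 0 ≤ f → 0 ≤ ℓ f)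
    (h1 : ℓ 1 = 1) :
    ∃ w : UnitDF, ∀ (f : ℝ → ℝ) (hf : ContinuousOn f (Icc 0 1)),
      ∫ t in Icc 0 1, f t ∂w.measure = ℓ (toUnitC f hf) := by
  let L : CompactlySupportedContinuousMap (Icc (0 : ℝ) 1) ℝ →ₗ[ℝ] ℝ :=
    { toFun := fun f => ℓ f.toContinuousMap
      map_add' := fun f g => ℓ.map_add _ _
      map_smul' := fun c f => ℓ.map_smul c _ }
  let Λ : CompactlySupportedContinuousMap (Icc (0 : ℝ) 1) ℝ →ₚ[ℝ] ℝ :=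
    PositiveLinearMap.mk₀ L fun f hf => hpos _ hf
  set μ := RealRMK.rieszMeasure Λ with hμ
  have hint : ∀ f : C(Icc (0 : ℝ) 1, ℝ), ∫ x, f x ∂μ = ℓ f := fun f =>
    RealRMK.integral_rieszMeasure Λ (CompactlySupportedContinuousMap.continuousMapEquiv f)
  have hprob : IsProbabilityMeasure μ := by
    constructor
    have h := hint 1
    simp only [ContinuousMap.one_apply, integral_const, smul_eq_mul, mul_one, h1,
      Measure.real] at h
    exact (ENNReal.toReal_eq_one_iff _).1 h
  have hν : IsProbabilityMeasure (μ.map Subtype.val) :=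
    Measure.isProbabilityMeasure_map measurable_subtype_coe.aemeasurable
  let w : UnitDF :=
    { toStieltjesFunction := ProbabilityTheory.cdf (μ.map Subtype.val)
      eq_zero' := fun t ht => by
        rw [ProbabilityTheory.cdf_eq_real, map_measureReal_apply measurable_subtype_coe
          measurableSet_Iic]
        have : (Subtype.val : Icc (0 : ℝ) 1 → ℝ) ⁻¹' Iic t = ∅ :=
          eq_empty_of_forall_notMem fun x hx => by
            have : (x : ℝ) ≤ t := hx
            linarith [x.2.1]
        rw [this, measureReal_empty]
      eq_one' := fun t ht => by
        rw [ProbabilityTheory.cdf_eq_real, map_measureReal_apply measurable_subtype_coe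
          measurableSet_Iic]
        have : (Subtype.val : Icc (0 : ℝ) 1 → ℝ) ⁻¹' Iic t = univ :=
          eq_univ_of_forall fun x => x.2.2.trans ht
        rw [this, probReal_univ] }
  refine ⟨w, fun f hf => ?_⟩
  have hw : w.measure = μ.map Subtype.val := ProbabilityTheory.measure_cdf _
  rw [hw, (MeasurableEmbedding.subtype_coe measurableSet_Icc).setIntegral_map,
    Subtype.coe_preimage_self, Measure.restrict_univ, ← hint]
  rfl

theorem continuous_setIntegral {f : ℝ → ℝ} (hf : ContinuousOn f (Icc 0 1)) :
    Continuous fun w : UnitDF => ∫ t in Icc 0 1, f t ∂w.measure :=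
  continuous_iInf_dom (i := f) (continuous_iInf_dom (i := hf) continuous_induced_dom)

theorem abs_setIntegral_le (w : UnitDF) {f : ℝ → ℝ} {C : ℝ} (hC : ∀ t ∈ Icc (0 : ℝ) 1, |f t| ≤ C) :
    |∫ t in Icc 0 1, f t ∂w.measure| ≤ C := by
  have := w.isProbabilityMeasure
  have hC0 : 0 ≤ C := (abs_nonneg _).trans (hC 0 (by simp))
  refine (norm_setIntegral_le_of_norm_le_const (f := f) (C := C) (measure_lt_top _ _) hC).trans ?_
  exact mul_le_of_le_one_right hC0 measureReal_le_one

theorem integrableOn (w : UnitDF) {f : ℝ → ℝ} (hf : ContinuousOn f (Icc 0 1)) :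
    IntegrableOn f (Icc 0 1) w.measure := by
  have := w.isProbabilityMeasure
  exact hf.integrableOn_compact isCompact_Icc

theorem setIntegral_const (w : UnitDF) (c : ℝ) : ∫ _ in Icc (0 : ℝ) 1, c ∂w.measure = c := by
  have h := w.isProbabilityMeasure
  have h1 : w.measure.real (Icc 0 1) = 1 := by
    rw [← Ioc_insert_left zero_le_one, insert_eq, measureReal_union (by simp) measurableSet_Ioc,
      w.measureReal_singleton_zero, w.measureReal_Ioc]
    ring
  rw [MeasureTheory.setIntegral_const, h1, one_smul]

/-- Along an ultrafilter the integrals of each continuous f converge, being bounded by ‖f‖. The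
limits form a positive normalized linear functional, and its Riesz representative is the limit
point. -/
instance : CompactSpace UnitDF := by
  refine ⟨isCompact_iff_ultrafilter_le_nhds.2 fun F _ => ?_⟩
  let I : C(Icc (0 : ℝ) 1, ℝ) → UnitDF → ℝ := fun f w =>
    ∫ t in Icc 0 1, IccExtend zero_le_one f t ∂w.measure
  have hcont : ∀ f : C(Icc (0 : ℝ) 1, ℝ), ContinuousOn (IccExtend zero_le_one f) (Icc 0 1) :=
    fun f => f.continuous.Icc_extend'.continuousOn
  have hlim : ∀ f, ∃ x, Tendsto (I f) F (𝓝 x) := by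
    intro f
    have hb : ∀ w, I f w ∈ Icc (-‖f‖) ‖f‖ := fun w =>
      abs_le.1 (w.abs_setIntegral_le fun t _ => f.norm_coe_le_norm _)
    obtain ⟨x, -, hx⟩ := isCompact_iff_ultrafilter_le_nhds.1 (isCompact_Icc (a := -‖f‖) (b := ‖f‖))
      (F.map (I f)) (le_principal_iff.2 (mem_map.2 (Eventually.of_forall hb)))
    exact ⟨x, hx⟩
  choose ℓ hℓ using hlim
  let L : C(Icc (0 : ℝ) 1, ℝ) →ₗ[ℝ] ℝ :=
    { toFun := ℓ
      map_add' := fun f g => tendsto_nhds_unique (hℓ (f + g)) <|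
        ((hℓ f).add (hℓ g)).congr fun w =>
          (integral_add (w.integrableOn (hcont f)) (w.integrableOn (hcont g))).symm
      map_smul' := fun c f => tendsto_nhds_unique (hℓ (c • f)) <|
        ((hℓ f).const_mul c).congr fun w => (integral_const_mul c _).symm }
  obtain ⟨w, hw⟩ := exists_setIntegral_eq L
    (fun f hf => ge_of_tendsto' (hℓ f) fun w => integral_nonneg fun t => hf _)
    (tendsto_nhds_unique (hℓ 1) (tendsto_const_nhds.congr fun w => (w.setIntegral_const 1).symm))
  refine ⟨w, mem_univ _, ?_⟩
  rw [nhds_iInf]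
  refine le_iInf fun f => ?_
  rw [nhds_iInf]
  refine le_iInf fun hf => ?_
  rw [nhds_induced, ← tendsto_iff_comap, hw f hf]
  refine (hℓ (toUnitC f hf)).congr fun w => ?_
  refine setIntegral_congr_fun measurableSet_Icc fun t ht => ?_
  rw [IccExtend_of_mem _ _ ht]
  rfl

end UnitDF

/-! ### Supporting functionals by Hahn–Banach -/

section Subgradient

variable {Ω : Type*} [MeasurableSpace Ω] {P : Measure Ω}

theorem integral_quantileExt_congr {X : Lp ℝ ∞ P} {φ : ℝ → ℝ}
    (h : ∀ t ∈ Ico (0 : ℝ) 1, quantileExt X t = φ t) {s : ℝ} (hs : s ∈ Icc (0 : ℝ) 1) :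
    ∫ u in (0 : ℝ)..s, quantileExt X u = ∫ u in (0 : ℝ)..s, φ u := by
  rw [intervalIntegral.integral_of_le hs.1, intervalIntegral.integral_of_le hs.1,
    integral_Ioc_eq_integral_Ioo, integral_Ioc_eq_integral_Ioo]
  exact setIntegral_congr_fun measurableSet_Ioo fun u hu => h u ⟨hu.1.le, hu.2.trans_le hs.2⟩

theorem avgVaR_congr {X Y : Lp ℝ ∞ P}
    (h : ∀ t ∈ Ico (0 : ℝ) 1, quantileExt X t = quantileExt Y t) {s : ℝ}
    (hs : s ∈ Icc (0 : ℝ) 1) : avgVaR X s = avgVaR Y s := by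
  unfold avgVaR
  rw [h 0 (by simp), integral_quantileExt_congr h hs]

variable [IsProbabilityMeasure P]

theorem avgVaR_smul_add_const (X : Lp ℝ ∞ P) {a : ℝ} (ha : 0 ≤ a) (c : ℝ) {s : ℝ}
    (hs : s ∈ Icc (0 : ℝ) 1) :
    avgVaR (a • X + Lp.const ∞ P c) s = a * avgVaR X s - c := by
  unfold avgVaR
  split_ifs with h
  · rw [quantileExt_smul_add_const X ha c (by simp)]; ring
  · rw [integral_quantileExt_congr (fun t ht => quantileExt_smul_add_const X ha c ht) hs,
      intervalIntegral.integral_add ((monotone_quantileExt X).intervalIntegrable.const_mul a)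
        intervalIntegrable_const, intervalIntegral.integral_const_mul,
      intervalIntegral.integral_const]
    simp only [sub_zero, smul_eq_mul]
    field_simp
    ring

theorem avgVaR_add_const (X : Lp ℝ ∞ P) (c : ℝ) {s : ℝ} (hs : s ∈ Icc (0 : ℝ) 1) :
    avgVaR (X + Lp.const ∞ P c) s = avgVaR X s - c := by
  have := avgVaR_smul_add_const X zero_le_one c hs
  rwa [one_smul, one_mul] at this

theorem avgVaR_smul (X : Lp ℝ ∞ P) {a : ℝ} (ha : 0 ≤ a) {s : ℝ} (hs : s ∈ Icc (0 : ℝ) 1) :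
    avgVaR (a • X) s = a * avgVaR X s := by
  have := avgVaR_smul_add_const X ha 0 hs
  rwa [map_zero, add_zero, sub_zero] at this

theorem ssDominates_of_avgVaR_le {X Y : Lp ℝ ∞ P}
    (h : ∀ s ∈ Icc (0 : ℝ) 1, avgVaR X s ≤ avgVaR Y s) : SSDominates X Y := by
  refine ssDominates_of_integral_quantileExt_le fun s hs => ?_
  rcases hs.1.eq_or_lt with rfl | h0
  · simp
  · have h1 := h s hs
    rw [avgVaR, avgVaR, if_neg h0.ne', if_neg h0.ne', neg_le_neg_iff] at h1
    exact le_of_mul_le_mul_left h1 (inv_pos.2 h0)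

variable {ρ : Lp ℝ ∞ P → ℝ}

theorem IsSSDConsistent.le_of_avgVaR_le (hρ : IsSSDConsistent ρ) {X Y : Lp ℝ ∞ P}
    (h : ∀ s ∈ Icc (0 : ℝ) 1, avgVaR X s ≤ avgVaR Y s) : ρ X ≤ ρ Y :=
  hρ.ssd X Y (ssDominates_of_avgVaR_le h)

theorem IsSSDConsistent.eq_of_avgVaR_eq (hρ : IsSSDConsistent ρ) {X Y : Lp ℝ ∞ P}
    (h : ∀ s ∈ Icc (0 : ℝ) 1, avgVaR X s = avgVaR Y s) : ρ X = ρ Y :=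
  le_antisymm (hρ.le_of_avgVaR_le fun s hs => (h s hs).le)
    (hρ.le_of_avgVaR_le fun s hs => (h s hs).ge)

/-- An SSD-consistent CoM-convex risk measure is convex as a function of the average value at risk
curve, and the curves form a convex set. -/
theorem IsCoMConvex.exists_avgVaR_eq (hP : IsNonatomicSpace P) (hρ : IsSSDConsistent ρ)
    (hc : IsCoMConvex ρ) (X Y : Lp ℝ ∞ P) {a : ℝ} (h₀ : 0 ≤ a) (h₁ : a ≤ 1) :
    ∃ W : Lp ℝ ∞ P,
      (∀ s ∈ Icc (0 : ℝ) 1, avgVaR W s = a * avgVaR X s + (1 - a) * avgVaR Y s) ∧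
      ρ W ≤ a * ρ X + (1 - a) * ρ Y := by
  obtain ⟨X', Y', hcom, hX, hY, hXY⟩ := exists_comonotonic_copies hP X Y
  refine ⟨a • X' + (1 - a) • Y', fun s hs => ?_, ?_⟩
  · have h := hXY a h₀ h₁
    unfold avgVaR
    split_ifs with h0
    · rw [h 0 (by simp)]; ring
    · rw [integral_quantileExt_congr h hs, intervalIntegral.integral_add
        ((monotone_quantileExt X).intervalIntegrable.const_mul a)
        ((monotone_quantileExt Y).intervalIntegrable.const_mul (1 - a)),
        intervalIntegral.integral_const_mul, intervalIntegral.integral_const_mul]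
      ring
  · rw [← hρ.eq_of_avgVaR_eq fun s hs => avgVaR_congr hX hs,
      ← hρ.eq_of_avgVaR_eq fun s hs => avgVaR_congr hY hs]
    exact hc.convexity X' Y' hcom a h₀ h₁

/-- The average value at risk curve as an element of `C[0,1]`. -/
noncomputable def avgVaRCurve (X : Lp ℝ ∞ P) : C(Icc (0 : ℝ) 1, ℝ) :=
  UnitDF.toUnitC (avgVaR X) (continuousOn_avgVaR X)

@[simp]
theorem avgVaRCurve_apply (X : Lp ℝ ∞ P) (s : Icc (0 : ℝ) 1) : avgVaRCurve X s = avgVaR X s := rfl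

/-- The difference quotients whose infimum is the directional derivative at `X`, in direction `f`,
of `ρ` viewed as a function of the average value at risk curve. -/
def diffQuotients (ρ : Lp ℝ ∞ P → ℝ) (X : Lp ℝ ∞ P) (f : C(Icc (0 : ℝ) 1, ℝ)) : Set ℝ :=
  {r | ∃ t : ℝ, 0 < t ∧ ∃ Y : Lp ℝ ∞ P,
    (∀ s : Icc (0 : ℝ) 1, avgVaR X s + t * f s ≤ avgVaR Y s) ∧ r = (ρ Y - ρ X) / t}

/-- Withdrawing cash c from X raises both its curve and its risk by c. -/
theorem mem_diffQuotients_of_le (hρ : IsSSDConsistent ρ) (X : Lp ℝ ∞ P)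
    {f : C(Icc (0 : ℝ) 1, ℝ)} {c : ℝ} (h : ∀ s, f s ≤ c) : c ∈ diffQuotients ρ X f := by
  refine ⟨1, one_pos, X + Lp.const ∞ P (-c), fun s => ?_, ?_⟩
  · rw [avgVaR_add_const X (-c) s.2]
    linarith [h s]
  · rw [hρ.translation]; ring

/-- Withdrawing cash t‖f‖ from Y lifts its curve above that of X, so ρ(X) ≤ ρ(Y) + t‖f‖. This keeps
the infimum finite. -/
theorem neg_norm_le_of_mem_diffQuotients (hρ : IsSSDConsistent ρ) {X : Lp ℝ ∞ P}
    {f : C(Icc (0 : ℝ) 1, ℝ)} {r : ℝ} (hr : r ∈ diffQuotients ρ X f) : -‖f‖ ≤ r := by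
  obtain ⟨t, ht, Y, hY, rfl⟩ := hr
  rw [le_div_iff₀ ht]
  have h : ρ X ≤ ρ (Y + Lp.const ∞ P (-(t * ‖f‖))) := by
    refine hρ.le_of_avgVaR_le fun s hs => ?_
    have h1 := hY ⟨s, hs⟩
    rw [avgVaR_add_const Y _ hs]
    have h2 := mul_le_mul_of_nonneg_left (neg_le_of_abs_le (f.norm_coe_le_norm ⟨s, hs⟩)) ht.le
    linarith
  rw [hρ.translation] at h
  linarith

/-- A supporting functional of `ρ` at `X`, in terms of average value at risk curves. -/
theorem IsCoMConvex.exists_subgradient (hP : IsNonatomicSpace P) (hρ : IsSSDConsistent ρ)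
    (hc : IsCoMConvex ρ) (X : Lp ℝ ∞ P) :
    ∃ ℓ : C(Icc (0 : ℝ) 1, ℝ) →ₗ[ℝ] ℝ, (∀ f, 0 ≤ f → 0 ≤ ℓ f) ∧ ℓ 1 = 1 ∧
      ∀ Y, ℓ (avgVaRCurve Y) - ℓ (avgVaRCurve X) ≤ ρ Y - ρ X := by
  set p : C(Icc (0 : ℝ) 1, ℝ) → ℝ := fun f => sInf (diffQuotients ρ X f) with hp
  have hbdd : ∀ f, BddBelow (diffQuotients ρ X f) :=
    fun f => ⟨-‖f‖, fun r hr => neg_norm_le_of_mem_diffQuotients hρ hr⟩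
  have hne : ∀ f, (diffQuotients ρ X f).Nonempty := fun f =>
    ⟨‖f‖, mem_diffQuotients_of_le hρ X fun s => le_of_abs_le (f.norm_coe_le_norm s)⟩
  have hle : ∀ f : C(Icc (0 : ℝ) 1, ℝ), ∀ c : ℝ, (∀ s, f s ≤ c) → p f ≤ c :=
    fun f c h => csInf_le (hbdd f) (mem_diffQuotients_of_le hρ X h)
  have hsmul_le : ∀ c : ℝ, 0 < c → ∀ f, p (c • f) ≤ c * p f := by
    intro c hc0 f
    rw [← div_le_iff₀' hc0]
    refine le_csInf (hne f) ?_
    rintro r ⟨t, ht, Y, hY, rfl⟩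
    rw [div_le_iff₀' hc0]
    refine csInf_le (hbdd _) ⟨t / c, div_pos ht hc0, Y, ?_, ?_⟩
    · intro s
      have h : t / c * (c • f) s = t * f s := by
        rw [ContinuousMap.smul_apply, smul_eq_mul]; field_simp
      rw [h]
      exact hY s
    · field_simp
  have hsmul : ∀ c : ℝ, 0 < c → ∀ f, p (c • f) = c * p f := by
    intro c hc0 f
    refine le_antisymm (hsmul_le c hc0 f) ?_
    have h := hsmul_le c⁻¹ (inv_pos.2 hc0) (c • f)
    rw [smul_smul, inv_mul_cancel₀ hc0.ne', one_smul] at h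
    rwa [← div_eq_inv_mul, le_div_iff₀' hc0] at h
  have hadd : ∀ f g, p (f + g) ≤ p f + p g := by
    intro f g
    rw [← sub_le_iff_le_add]
    refine le_csInf (hne f) ?_
    rintro r₁ ⟨t, ht, Y, hY, rfl⟩
    rw [sub_le_comm]
    refine le_csInf (hne g) ?_
    rintro r₂ ⟨s, hs, Z, hZ, rfl⟩
    rw [sub_le_iff_le_add']
    have hst : 0 < s + t := add_pos hs ht
    -- The weights s/(s+t) and t/(s+t) give the increments t·f and s·g the same coefficient
    -- st/(s+t), which is the step size for f + g.
    obtain ⟨W, hW, hWρ⟩ := hc.exists_avgVaR_eq hP hρ Y Z (a := s / (s + t))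
      (div_nonneg hs.le hst.le) ((div_le_one hst).2 (by linarith))
    have h1 : 1 - s / (s + t) = t / (s + t) := by field_simp; ring
    rw [h1] at hW hWρ
    have hmem : (ρ W - ρ X) / (s * t / (s + t)) ∈ diffQuotients ρ X (f + g) := by
      refine ⟨s * t / (s + t), div_pos (mul_pos hs ht) hst, W, fun u => ?_, rfl⟩
      have h2 := hY u
      have h3 := hZ u
      rw [hW u u.2, ← sub_nonneg, ContinuousMap.add_apply]
      have h4 : s / (s + t) * avgVaR Y u + t / (s + t) * avgVaR Z u -
          (avgVaR X u + s * t / (s + t) * (f u + g u)) =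
          (s * (avgVaR Y u - (avgVaR X u + t * f u)) +
            t * (avgVaR Z u - (avgVaR X u + s * g u))) / (s + t) := by
        field_simp; ring
      rw [h4]
      exact div_nonneg (add_nonneg (mul_nonneg hs.le (sub_nonneg.2 h2))
        (mul_nonneg ht.le (sub_nonneg.2 h3))) hst.le
    refine (csInf_le (hbdd _) hmem).trans ?_
    rw [div_le_iff₀ (div_pos (mul_pos hs ht) hst)]
    have h5 : ((ρ Y - ρ X) / t + (ρ Z - ρ X) / s) * (s * t / (s + t)) =
        s / (s + t) * ρ Y + t / (s + t) * ρ Z - ρ X := by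
      field_simp; ring
    linarith
  have hp0 : 0 ≤ p 0 := by
    have h := hsmul 2 two_pos 0
    rw [smul_zero] at h
    linarith
  -- Extending the zero functional from the trivial subspace suffices: positivity and normalization
  -- follow from p(f) ≤ c whenever f ≤ c, applied to -f, 1 and -1.
  obtain ⟨ℓ, -, hℓ⟩ := exists_extension_of_le_sublinear (⊥ : C(Icc (0 : ℝ) 1, ℝ) →ₗ.[ℝ] ℝ) p
    hsmul hadd fun x => by
      have hx : x = 0 := Subsingleton.elim (α := (⊥ : Submodule ℝ C(Icc (0 : ℝ) 1, ℝ))) x 0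
      rw [hx, LinearPMap.map_zero]
      exact hp0
  refine ⟨ℓ, fun f hf => ?_, le_antisymm ?_ ?_, fun Y => ?_⟩
  · have h := (hℓ (-f)).trans (hle (-f) 0 fun s => neg_nonpos.2 (hf s))
    rw [map_neg] at h
    linarith
  · exact (hℓ 1).trans (hle 1 1 fun s => le_rfl)
  · have h := (hℓ (-1)).trans (hle (-1) (-1) fun s => le_rfl)
    rw [map_neg] at h
    linarith
  · rw [← map_sub]
    refine (hℓ _).trans (csInf_le (hbdd _) ⟨1, one_pos, Y, fun s => ?_, by simp⟩)
    simp

theorem IsCoMConvex.exists_unitDF (hP : IsNonatomicSpace P) (hρ : IsSSDConsistent ρ)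
    (hc : IsCoMConvex ρ) (X : Lp ℝ ∞ P) :
    ∃ w : UnitDF, ∀ Y : Lp ℝ ∞ P, (∫ s in Icc 0 1, avgVaR Y s ∂w.measure) -
      ∫ s in Icc 0 1, avgVaR X s ∂w.measure ≤ ρ Y - ρ X := by
  obtain ⟨ℓ, hpos, h1, hℓ⟩ := hc.exists_subgradient hP hρ X
  obtain ⟨w, hw⟩ := UnitDF.exists_setIntegral_eq ℓ hpos h1
  refine ⟨w, fun Y => ?_⟩
  rw [hw _ (continuousOn_avgVaR Y), hw _ (continuousOn_avgVaR X)]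
  exact hℓ Y

end Subgradient

/-! ### Minimal penalty and the coherent case -/

section Representation

variable {Ω : Type*} [MeasurableSpace Ω] {P : Measure Ω}

/-- The minimal penalty functional of `ρ` on `Ψ`. -/
noncomputable def minimalPenalty (ρ : Lp ℝ ∞ P → ℝ) (ψ : ConcaveDF) : EReal :=
  ⨆ X : Lp ℝ ∞ P, (((∫ t in Icc (0 : ℝ) 1, VaR t X ∂ψ.measure) - ρ X : ℝ) : EReal)

theorem minimalPenalty_ne_bot (ρ : Lp ℝ ∞ P → ℝ) (ψ : ConcaveDF) : minimalPenalty ρ ψ ≠ ⊥ :=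
  ne_bot_of_le_ne_bot (EReal.coe_ne_bot _) (le_iSup (fun X : Lp ℝ ∞ P =>
    (((∫ t in Icc (0 : ℝ) 1, VaR t X ∂ψ.measure) - ρ X : ℝ) : EReal)) 0)

variable [IsProbabilityMeasure P]

/-- VaR need not be continuous in its level. The transported topology reduces the claim to
composition with J, where the integrand becomes the continuous curve `avgVaR X`. -/
theorem continuous_setIntegral_VaR (X : Lp ℝ ∞ P) :
    Continuous fun ψ : ConcaveDF => ∫ t in Icc (0 : ℝ) 1, VaR t X ∂ψ.measure := by
  refine continuous_coinduced_dom.2 ?_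
  exact (UnitDF.continuous_setIntegral (continuousOn_avgVaR X)).congr
    fun w => (setIntegral_VaR_J w X).symm

theorem setIntegral_VaR_mix (X : Lp ℝ ∞ P) {a : ℝ} (h₀ : 0 ≤ a) (h₁ : a ≤ 1) (φ ψ : ConcaveDF) :
    ∫ t in Icc (0 : ℝ) 1, VaR t X ∂(ConcaveDF.mix a h₀ h₁ φ ψ).measure =
      a * (∫ t in Icc (0 : ℝ) 1, VaR t X ∂φ.measure) +
        (1 - a) * ∫ t in Icc (0 : ℝ) 1, VaR t X ∂ψ.measure :=
  UnitDF.setIntegral_of_mix (w := (ConcaveDF.mix a h₀ h₁ φ ψ).toUnitDF) h₀ h₁ (fun _ => rfl)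
    (integrableOn_VaR φ X) (integrableOn_VaR ψ X)

variable (ρ : Lp ℝ ∞ P → ℝ)

theorem lowerSemicontinuous_minimalPenalty : LowerSemicontinuous (minimalPenalty ρ) :=
  lowerSemicontinuous_iSup fun X => (continuous_coe_real_ereal.comp
    ((continuous_setIntegral_VaR X).sub continuous_const)).lowerSemicontinuous

theorem convexFunctional_minimalPenalty : ConcaveDF.ConvexFunctional (minimalPenalty ρ) := by
  intro φ ψ a h₀ h₁
  refine iSup_le fun X => ?_
  have h : ((∫ t in Icc (0 : ℝ) 1, VaR t X ∂(ConcaveDF.mix a h₀ h₁ φ ψ).measure) - ρ X : ℝ) =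
      a * ((∫ t in Icc (0 : ℝ) 1, VaR t X ∂φ.measure) - ρ X) +
        (1 - a) * ((∫ t in Icc (0 : ℝ) 1, VaR t X ∂ψ.measure) - ρ X) := by
    rw [setIntegral_VaR_mix]; ring
  rw [h, EReal.coe_add, EReal.coe_mul, EReal.coe_mul]
  exact add_le_add
    (mul_le_mul_of_nonneg_left (le_iSup (fun X : Lp ℝ ∞ P =>
      (((∫ t in Icc (0 : ℝ) 1, VaR t X ∂φ.measure) - ρ X : ℝ) : EReal)) X)
      (EReal.coe_nonneg.2 h₀))
    (mul_le_mul_of_nonneg_left (le_iSup (fun X : Lp ℝ ∞ P =>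
      (((∫ t in Icc (0 : ℝ) 1, VaR t X ∂ψ.measure) - ρ X : ℝ) : EReal)) X)
      (EReal.coe_nonneg.2 (sub_nonneg.2 h₁)))

variable {ρ}

/-- The upper bound is built into the penalty. If w supports ρ at X, then X itself attains the
supremum defining the penalty of J w, which gives equality. -/
theorem isGreatest_sub_minimalPenalty (hP : IsNonatomicSpace P) (hρ : IsSSDConsistent ρ)
    (hc : IsCoMConvex ρ) (X : Lp ℝ ∞ P) :
    IsGreatest (Set.range fun ψ : ConcaveDF =>
      ((∫ t in Icc (0 : ℝ) 1, VaR t X ∂ψ.measure : ℝ) : EReal) - minimalPenalty ρ ψ)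
      (ρ X : EReal) := by
  have hle : ∀ ψ : ConcaveDF,
      (((∫ t in Icc (0 : ℝ) 1, VaR t X ∂ψ.measure) - ρ X : ℝ) : EReal) ≤ minimalPenalty ρ ψ :=
    fun ψ => le_iSup (fun X : Lp ℝ ∞ P =>
      (((∫ t in Icc (0 : ℝ) 1, VaR t X ∂ψ.measure) - ρ X : ℝ) : EReal)) X
  constructor
  · obtain ⟨w, hw⟩ := hc.exists_unitDF hP hρ X
    have h : minimalPenalty ρ w.J =
        (((∫ t in Icc (0 : ℝ) 1, VaR t X ∂w.J.measure) - ρ X : ℝ) : EReal) := by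
      refine le_antisymm (iSup_le fun Y => EReal.coe_le_coe_iff.2 ?_) (hle w.J)
      rw [setIntegral_VaR_J, setIntegral_VaR_J]
      linarith [hw Y]
    refine ⟨w.J, ?_⟩
    simp only [h]
    rw [← EReal.coe_sub, sub_sub_cancel]
  · rintro _ ⟨ψ, rfl⟩
    refine (EReal.sub_le_sub le_rfl (hle ψ)).trans ?_
    rw [← EReal.coe_sub, sub_sub_cancel]

/-- In the coherent case the supporting functionals are dominated by `ρ`. -/
theorem IsCoMCoherent.exists_unitDF (hP : IsNonatomicSpace P) (hρ : IsSSDConsistent ρ)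
    (hc : IsCoMCoherent ρ) (X : Lp ℝ ∞ P) :
    ∃ w : UnitDF, (∀ Y : Lp ℝ ∞ P, ∫ s in Icc 0 1, avgVaR Y s ∂w.measure ≤ ρ Y) ∧
      ∫ s in Icc 0 1, avgVaR X s ∂w.measure = ρ X := by
  obtain ⟨w, hw⟩ := hc.toIsCoMConvex.exists_unitDF hP hρ X
  have hsmul : ∀ (Y : Lp ℝ ∞ P) (a : ℝ), 0 ≤ a → ∫ s in Icc 0 1, avgVaR (a • Y) s ∂w.measure =
      a * ∫ s in Icc 0 1, avgVaR Y s ∂w.measure := by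
    intro Y a ha
    rw [← integral_const_mul]
    exact setIntegral_congr_fun measurableSet_Icc fun s hs => avgVaR_smul Y ha hs
  have hX : ∫ s in Icc 0 1, avgVaR X s ∂w.measure = ρ X := by
    -- Testing the subgradient inequality at 2X and at 0 bounds the integral by ρ(X) from above and
    -- from below.
    have h2 := hw ((2 : ℝ) • X)
    have h0 := hw ((0 : ℝ) • X)
    rw [hsmul X 2 zero_le_two, hc.homogeneity X 2 zero_le_two] at h2
    rw [hsmul X 0 le_rfl, hc.homogeneity X 0 le_rfl] at h0
    linarith
  refine ⟨w, fun Y => ?_, hX⟩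
  have h := hw Y
  linarith

end Representation

theorem mainTheorem12 {Ω : Type*} [MeasurableSpace Ω] (P : Measure Ω) [IsProbabilityMeasure P]
    (hP : IsNonatomicSpace P) (ρ : Lp ℝ ∞ P → ℝ) (hρ : IsSSDConsistent ρ) :
    (IsCoMConvex ρ →
      ∃ α : ConcaveDF → EReal,
        (∀ ψ, α ψ ≠ ⊥) ∧ LowerSemicontinuous α ∧ ConcaveDF.ConvexFunctional α ∧
        ∀ X : Lp ℝ ∞ P,
          IsGreatest
            (Set.range fun ψ : ConcaveDF =>
              ((∫ t in Set.Icc (0 : ℝ) 1, VaR t X ∂ψ.measure : ℝ) : EReal) - α ψ)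
            (ρ X : EReal)) ∧
    (IsCoMCoherent ρ →
      ∃ Ψ₁ : Set ConcaveDF,
        Ψ₁.Nonempty ∧ IsCompact Ψ₁ ∧ ConcaveDF.ConvexSubset Ψ₁ ∧
        ∀ X : Lp ℝ ∞ P,
          IsGreatest
            ((fun ψ : ConcaveDF => ∫ t in Set.Icc (0 : ℝ) 1, VaR t X ∂ψ.measure) '' Ψ₁)
            (ρ X)) := by
  refine ⟨fun hc => ⟨minimalPenalty ρ, minimalPenalty_ne_bot ρ,
    lowerSemicontinuous_minimalPenalty ρ,
    convexFunctional_minimalPenalty ρ, isGreatest_sub_minimalPenalty hP hρ hc⟩, fun hc => ?_⟩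
  -- The dominated set is formed in 𝒲, where compactness is available; J is continuous for the
  -- coinduced topology and respects mixtures, so compactness and convexity pass to the image.
  set K : Set UnitDF := {w | ∀ Y : Lp ℝ ∞ P, ∫ s in Icc 0 1, avgVaR Y s ∂w.measure ≤ ρ Y} with hK
  have hKc : IsCompact K := by
    refine IsClosed.isCompact ?_
    simp only [hK, ofPred_forall]
    exact isClosed_iInter fun Y =>
      isClosed_le (UnitDF.continuous_setIntegral (continuousOn_avgVaR Y)) continuous_const
  refine ⟨UnitDF.J '' K, ?_, hKc.image continuous_coinduced_rng, ?_, fun X => ⟨?_, ?_⟩⟩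
  · obtain ⟨w, hw, -⟩ := hc.exists_unitDF hP hρ 0
    exact ⟨w.J, w, hw, rfl⟩
  · rintro _ ⟨w₁, hw₁, rfl⟩ _ ⟨w₂, hw₂, rfl⟩ a h₀ h₁
    refine ⟨UnitDF.mix a h₀ h₁ w₁ w₂, fun Y => ?_, UnitDF.J_mix a h₀ h₁ w₁ w₂⟩
    rw [UnitDF.setIntegral_of_mix h₀ h₁ (fun _ => rfl) (w₁.integrableOn (continuousOn_avgVaR Y))
      (w₂.integrableOn (continuousOn_avgVaR Y))]
    have h₂ := mul_le_mul_of_nonneg_left (hw₁ Y) h₀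
    have h₃ := mul_le_mul_of_nonneg_left (hw₂ Y) (sub_nonneg.2 h₁)
    linarith
  · obtain ⟨w, hw, hX⟩ := hc.exists_unitDF hP hρ X
    exact ⟨w.J, ⟨w, hw, rfl⟩, (setIntegral_VaR_J w X).trans hX⟩
  · rintro _ ⟨_, ⟨w, hw, rfl⟩, rfl⟩
    exact (setIntegral_VaR_J w X).trans_le (hw X)
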